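/- Let $S^2\subset\mathbb R^3$ be the unit sphere with round metric $\sigma_{\alpha\beta}$, Levi-Civita connection $\nabla$, Laplacian $\Delta=\nabla^\alpha\nabla_\alpha$ and area form $\epsilon_{\alpha\beta}$; put $\epsilon_\alpha^{\gamma}:=\sigma^{\gamma\delta}\epsilon_{\delta\alpha}$, so that $\epsilon_\alpha^\gamma p_\gamma$ is the Hodge dual of a one-form $p$. Let $X^1,X^2,X^3$ be the restrictions to $S^2$ of the coordinate functions of $\mathbb R^3$. All functions and tensors are smooth ($C^\infty$). Let $S_{\alpha\beta}$ be a symmetric traceless two-tensor on $S^2$. (1) There exists a one-form $p_\alpha$ such that \[S_{\alpha\beta}=\tfrac12\big(\nabla_\beta p_\alpha+\nabla_\alpha p_\beta-(\nabla^\gamma p_\gamma)\sigma_{\alpha\beta}\big).\qquad(*)\] (2) If the one-form $\nabla^\alpha S_{\alpha\beta}$ is closed, then the one-form $p_\alpha$ in $(*)$ can be chosen closed; more precisely, for every $p_\alpha$ satisfying $(*)$ there is a linear combination $h$ of $X^1,X^2,X^3$ such that $p_\alpha-\epsilon_\alpha^\gamma\nabla_\gamma h$ is closed. Moreover there exists a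 function $f$ such that \[S_{\alpha\beta}=\nabla_\alpha\nabla_\beta f-\tfrac12\sigma_{\alpha\beta}\Delta f,\] \[\nabla^\alpha S_{\alpha\beta}=\tfrac12\nabla_\beta(\Delta f+2f),\qquad \nabla^\beta\nabla^\alpha S_{\alpha\beta}=\tfrac12\Delta(\Delta f+2f),\] and a function $f'$ satisfies the first of these three identities if and only if $f'-f$ is a linear combination of $1,X^1,X^2,X^3$ (the spherical harmonics with $\ell\le1$). (3) If $\nabla^\alpha S_{\alpha\beta}$ is co-closed, that is $\nabla^\beta\nabla^\alpha S_{\alpha\beta}=0$, then there exists a function $g$ such that \[S_{\alpha\beta}=\tfrac12\big(\epsilon_\alpha^\gamma\nabla_\beta\nabla_\gamma g+\epsilon_\beta^\gamma\nabla_\alpha\nabla_\gamma g\big),\qquad \epsilon^{\gamma\beta}\nabla_\gamma\nabla^\alpha S_{\alpha\beta}=\tfrac12\Delta(\Delta g+2g),\] and a function $g'$ satisfies the first of these two identities if and only if $g'-g$ is a linear combination of $1,X^1,X^2,X^3$. -/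

import Mathlib

open scoped Manifold ContDiff

noncomputable section

namespace SphereTensor

/-- Euclidean three-space. -/
abbrev E3 := EuclideanSpace ℝ (Fin 3)

/-- The standard unit sphere `S²`, with Mathlib's smooth structure. -/
abbrev S2 := Metric.sphere (0 : E3) 1

instance factFinrankE3 : Fact (Module.finrank ℝ E3 = 2 + 1) := ⟨by simp⟩

/-- The `i`-th standard basis vector of `ℝ³`. -/
def e (i : Fin 3) : E3 := EuclideanSpace.single i 1

/-- Smooth (`C^∞`) maps from the manifold `S²` to a normed space. -/
def IsSmooth {F : Type*} [NormedAddCommGroup F] [NormedSpace ℝ F] (u : S2 → F) : Prop :=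
  ContMDiff (𝓡 2) 𝓘(ℝ, F) ∞ u

/-! The tangent plane `T_x S²` is the orthogonal complement of `x` in `ℝ³`. A covariant tensor at
`x` is represented by the multilinear form on `ℝ³` obtained from it by composing with the orthogonal
projection `ℝ³ → T_x S²`; these are exactly the multilinear forms on `ℝ³` that vanish as soon as one
of the arguments is `x`. For such forms, contracting two indices with the inverse round metric is
summation over an orthonormal basis of `ℝ³`, since the normal direction contributes zero. -/

/-- The orthogonal projection of `ℝ³` onto the tangent plane `T_x S²`. -/
def proj (x : S2) : E3 →L[ℝ] E3 :=
  ContinuousLinearMap.id ℝ E3 - (innerSL ℝ (x : E3)).smulRight (x : E3)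

/-- Smooth one-forms `p_α` on `S²`. -/
structure IsOneForm (p : S2 → E3 →L[ℝ] ℝ) : Prop where
  smooth : IsSmooth p
  tangential : ∀ x : S2, p x x = 0

/-- Smooth two-tensors `S_{αβ}` on `S²`; `S x v w` is `S_{αβ} v^α w^β`. -/
structure IsTwoTensor (S : S2 → E3 →L[ℝ] E3 →L[ℝ] ℝ) : Prop where
  smooth : IsSmooth S
  tangential_left : ∀ (x : S2) (w : E3), S x x w = 0
  tangential_right : ∀ (x : S2) (v : E3), S x v x = 0

def IsSymmetric (S : S2 → E3 →L[ℝ] E3 →L[ℝ] ℝ) : Prop :=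
  ∀ (x : S2) (v w : E3), S x v w = S x w v

/-- `σ^{αβ} S_{αβ} = 0`. -/
def IsTraceless (S : S2 → E3 →L[ℝ] E3 →L[ℝ] ℝ) : Prop :=
  ∀ x : S2, ∑ i, S x (e i) (e i) = 0

/-- The round metric `σ_{αβ}`. -/
def metric (x : S2) (v w : E3) : ℝ := inner ℝ (proj x v) (proj x w)

/-- The area form `ε_{αβ}` of `S²` (oriented by the outward normal): `areaForm x u v` is
`det (x, u, v) = ⟪x × u, v⟫`. -/
def areaForm (x : S2) (u : E3) : E3 →L[ℝ] ℝ :=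
  innerSL ℝ (WithLp.toLp 2 (crossProduct (x : E3).ofLp u.ofLp) : E3)

/-- The extension of a map on `S²` to `ℝ³` that is constant along rays (and zero at the origin). -/
def radialExt {F : Type*} [Zero F] (u : S2 → F) (y : E3) : F :=
  if h : y ≠ 0 then u ⟨‖y‖⁻¹ • y, by simp [norm_smul, h]⟩ else 0

/-- The differential at `x` of a vector-valued map on `S²`. On tangent vectors this is the
differential along the sphere, and it vanishes on the normal vector `x`. -/
def tderiv {F : Type*} [NormedAddCommGroup F] [NormedSpace ℝ F] (u : S2 → F) (x : S2) :
    E3 →L[ℝ] F :=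
  fderiv ℝ (radialExt u) x

/-- `∇_α f`, the differential of a function. -/
def nablaFun (f : S2 → ℝ) : S2 → E3 →L[ℝ] ℝ := fun x => tderiv f x

/-- The Levi-Civita derivative of a one-form on `S² ⊂ ℝ³`: the tangential part of the ambient
derivative. `nablaOne p x v w` is `v^α w^β ∇_α p_β`. -/
def nablaOne (p : S2 → E3 →L[ℝ] ℝ) (x : S2) (v : E3) : E3 →L[ℝ] ℝ :=
  (tderiv p x v).comp (proj x)

/-- The Levi-Civita derivative of a two-tensor on `S² ⊂ ℝ³`: the tangential part of the ambient
derivative. `nablaTwo S x u v w` is `u^α v^β w^γ ∇_α S_{βγ}`. -/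
def nablaTwo (S : S2 → E3 →L[ℝ] E3 →L[ℝ] ℝ) (x : S2) (u : E3) : E3 →L[ℝ] E3 →L[ℝ] ℝ :=
  (tderiv S x u).bilinearComp (proj x) (proj x)

/-- `∇^γ p_γ`. -/
def divOne (p : S2 → E3 →L[ℝ] ℝ) (x : S2) : ℝ := ∑ i, nablaOne p x (e i) (e i)

/-- The one-form `∇^α S_{αβ}`. -/
def divTwo (S : S2 → E3 →L[ℝ] E3 →L[ℝ] ℝ) (x : S2) : E3 →L[ℝ] ℝ :=
  ∑ i, nablaTwo S x (e i) (e i)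

/-- `ε^{γβ} ∇_γ p_β`. -/
def curlOne (p : S2 → E3 →L[ℝ] ℝ) (x : S2) : ℝ :=
  ∑ i, ∑ j, areaForm x (e i) (e j) * nablaOne p x (e i) (e j)

/-- The Hessian `∇_α ∇_β f`, as `hess f x v w = v^α w^β ∇_α ∇_β f`. -/
def hess (f : S2 → ℝ) (x : S2) (v : E3) : E3 →L[ℝ] ℝ := nablaOne (nablaFun f) x v

/-- The Laplacian `Δ f = ∇^α ∇_α f`. -/
def laplacian (f : S2 → ℝ) (x : S2) : ℝ := ∑ i, hess f x (e i) (e i)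

/-- `p` is closed: `∇_α p_β - ∇_β p_α = 0`. -/
def IsClosedForm (p : S2 → E3 →L[ℝ] ℝ) : Prop :=
  ∀ (x : S2) (v w : E3), nablaOne p x v w - nablaOne p x w v = 0

/-- `p` is co-closed: `∇^γ p_γ = 0`. -/
def IsCoclosedForm (p : S2 → E3 →L[ℝ] ℝ) : Prop := ∀ x : S2, divOne p x = 0

/-- `ε_α^γ p_γ`, where `ε_α^γ = σ^{γδ} ε_{δα}`; this is the Hodge dual of `p`. -/
def rot (p : S2 → E3 →L[ℝ] ℝ) (x : S2) : E3 →L[ℝ] ℝ := ∑ i, p x (e i) • areaForm x (e i)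

/-- `S_{αβ} = ½ (∇_β p_α + ∇_α p_β - (∇^γ p_γ) σ_{αβ})`. -/
def HasPotential (S : S2 → E3 →L[ℝ] E3 →L[ℝ] ℝ) (p : S2 → E3 →L[ℝ] ℝ) : Prop :=
  ∀ (x : S2) (v w : E3), S x v w =
    1 / 2 * (nablaOne p x w v + nablaOne p x v w - divOne p x * metric x v w)

/-- `S_{αβ} = ∇_α ∇_β f - ½ σ_{αβ} Δ f`. -/
def IsClosedRep (S : S2 → E3 →L[ℝ] E3 →L[ℝ] ℝ) (f : S2 → ℝ) : Prop :=
  ∀ (x : S2) (v w : E3), S x v w = hess f x v w - 1 / 2 * metric x v w * laplacian f x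

/-- `S_{αβ} = ½ (ε_α^γ ∇_β ∇_γ g + ε_β^γ ∇_α ∇_γ g)`, where `ε_α^γ = σ^{γδ} ε_{δα}`. -/
def IsCoclosedRep (S : S2 → E3 →L[ℝ] E3 →L[ℝ] ℝ) (g : S2 → ℝ) : Prop :=
  ∀ (x : S2) (v w : E3), S x v w =
    1 / 2 * ((∑ i, areaForm x (e i) v * hess g x w (e i)) +
      ∑ i, areaForm x (e i) w * hess g x v (e i))

/-- The linear function `X_b = Σ b_i X^i` on `S²`, where the `X^i` are the three coordinate functions
of the standard embedding. -/
def coordFun (b : E3) (x : S2) : ℝ := inner ℝ b (x : E3)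

/-- `u` is a linear combination of spherical harmonics with `ℓ ≤ 1`, that is, of `1` and the three
coordinate functions. -/
def IsLowHarmonic (u : S2 → ℝ) : Prop :=
  ∃ (a : ℝ) (b : E3), ∀ x : S2, u x = a + coordFun b x

end SphereTensor

end

open SphereTensor

/-!
The proof takes place in the ring `C^∞(S²)`, with the coordinate functions `x_i` (`coord i`) and the
three tangential derivations `δ_i` (`tanDeriv i`), the components of the gradient in `ℝ³`. They
satisfy `∑ x_i² = 1`, `∑ x_i δ_i = 0`, `δ_i x_j = δ_ij - x_i x_j` and
`δ_i δ_j - δ_j δ_i = x_i δ_j - x_j δ_i`. Covariant tensors are given by their components with respect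
to the standard basis of `ℝ³`, and each identity of tensor calculus on the sphere becomes a
polynomial identity modulo these relations; no charts or Christoffel symbols occur.

*Existence of `p`* (`exists_killing`). The equation to solve says that the conformal Killing operator
maps `p` to `2 S`. The coordinate vector fields `A`, `B` of a stereographic chart are global conformal
Killing fields, so that for `p = u₁ A + u₂ B` the equation is the inhomogeneous Cauchy–Riemann
equation for `u₁ + i u₂`. If `S` vanishes near the pole of the projection, the Cauchy transform solves
it (`exists_dbar`, from the Cauchy–Pompeiu formula); the solution tends to zero at infinity and is
holomorphic there, hence extends smoothly over the pole (`exists_cauchyRiemann`). A partition of unity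
and the two opposite poles give the general case. The same Cauchy–Riemann equations give the Hodge
decomposition `p = ∇F + x × ∇G` of one-forms, and therefore closed forms are exact
(`exists_grad_of_crl_eq_zero`): the remaining `G` is harmonic.

*Kernels.* Harmonic functions are constant, by the Bochner identity for `|∇v|²` and the maximum
principle (`eq_const_of_lap_eq_zero`). The solutions of `Δw + 2w = 0` are the linear functions, since
then `δ_j w + x_j w` is harmonic (`eq_linFun_of_lap`). The divergence of the trace-free Hessian of `u`
is `½ ∇(Δu + 2u)`, so the trace-free Hessian annihilates exactly the span of `1, X¹, X², X³`
(`killing_grad_eq_zero_iff`).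

*Closed divergence.* The curl of `∇^α S_αβ` is `½ (Δ + 2)` of the curl of `p`. If it vanishes, the
curl of `p` is a linear function, which is also the curl of a rotation field. Rotation fields are
Killing fields, so subtracting one leaves a closed, hence exact, potential of the same `S`
(`exists_crl_sub_eq_zero`, `exists_killing_grad`).

*Co-closed divergence.* Applying the Hodge dual to one index of a symmetric traceless tensor gives
such a tensor again (`isTraceFree_dualTensor`). This operation commutes with the divergence
(`dvgTwo_dualTensor`) and turns trace-free Hessians into the rotated Hessians of the theorem
(`rotated_hessian_iff`), so the co-closed case is the closed case for the dual tensor.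
-/

noncomputable section

namespace SphereTensor

open Filter Topology

section

/-! ### Smooth functions on the sphere and their radial extensions -/

lemma ne_zero (x : S2) : (x : E3) ≠ 0 := ne_zero_of_mem_unit_sphere x

lemma radialExt_coe {F : Type*} [Zero F] (u : S2 → F) (x : S2) : radialExt u (x : E3) = u x := by
  have hx : ‖(x : E3)‖ = 1 := by simp
  rw [radialExt, dif_pos (ne_zero x)]
  congr 1
  ext1
  simp [hx]

lemma radialExt_smul {F : Type*} [Zero F] (u : S2 → F) {t : ℝ} (ht : 0 < t) (y : E3) :
    radialExt u (t • y) = radialExt u y := by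
  by_cases hy : y = 0
  · simp [hy]
  · have hty : t • y ≠ 0 := smul_ne_zero ht.ne' hy
    rw [radialExt, radialExt, dif_pos hty, dif_pos hy]
    congr 2
    rw [norm_smul, smul_smul, Real.norm_of_nonneg ht.le]
    congr 1
    field_simp

variable {F : Type*} [NormedAddCommGroup F] [NormedSpace ℝ F]

lemma IsSmooth.contDiffAt_radialExt {u : S2 → F} (hu : IsSmooth u) {y : E3} (hy : y ≠ 0) :
    ContDiffAt ℝ ∞ (radialExt u) y := by
  let V : TopologicalSpace.Opens E3 := ⟨{0}ᶜ, isOpen_compl_singleton⟩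
  have hV : ∀ z : V, (z : E3) ≠ 0 := fun z => z.2
  have hn : ContMDiff 𝓘(ℝ, E3) 𝓘(ℝ, E3) ∞ (fun z : V => ‖(z : E3)‖⁻¹ • (z : E3)) := by
    intro z
    refine (contMDiffAt_subtype_iff (f := fun z : E3 => ‖z‖⁻¹ • z)).2 ?_
    refine ContDiffAt.contMDiffAt ?_
    exact ((contDiffAt_norm ℝ (hV z)).inv (norm_ne_zero_iff.2 (hV z))).smul contDiffAt_id
  have hn' := hn.codRestrict_sphere (n := 2) (fun z => by simp [norm_smul, hV z])
  have h := (ContMDiff.comp hu hn') ⟨y, hy⟩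
  have h2 : ContMDiffAt 𝓘(ℝ, E3) 𝓘(ℝ, F) ∞ (fun z : V => radialExt u z) ⟨y, hy⟩ := by
    refine h.congr_of_eventuallyEq (Eventually.of_forall fun z => ?_)
    simp only [radialExt, ne_eq, hV z, not_false_eq_true, dite_true]
    rfl
  exact (contMDiffAt_subtype_iff.1 h2).contDiffAt

lemma IsSmooth.differentiableAt_radialExt {u : S2 → F} (hu : IsSmooth u) {y : E3} (hy : y ≠ 0) :
    DifferentiableAt ℝ (radialExt u) y :=
  (hu.contDiffAt_radialExt hy).differentiableAt (by simp)

/-- A map that near each point is the restriction of a map smooth in the ambient space is smooth. -/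
lemma isSmooth_of_locally {u : S2 → F}
    (h : ∀ x : S2, ∃ U : E3 → F, ContDiffAt ℝ ∞ U x ∧ u =ᶠ[𝓝 x] fun y => U y) : IsSmooth u := by
  intro x
  obtain ⟨U, hU, huU⟩ := h x
  have h1 : ContMDiffAt (𝓡 2) 𝓘(ℝ, F) ∞ (fun y : S2 => U y) x :=
    ContMDiffAt.comp x (g := U) (f := fun y : S2 => (y : E3)) hU.contMDiffAt
      (contMDiff_coe_sphere (n := 2) x)
  exact h1.congr_of_eventuallyEq huU

lemma isSmooth_restrict {U : E3 → F} (hU : ∀ x : S2, ContDiffAt ℝ ∞ U x) :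
    IsSmooth (fun x : S2 => U x) :=
  isSmooth_of_locally fun x => ⟨U, hU x, Eventually.of_forall fun _ => rfl⟩

lemma IsSmooth.tderiv_apply {u : S2 → F} (hu : IsSmooth u) (v : E3) :
    IsSmooth (fun x => tderiv u x v) := by
  refine isSmooth_restrict (U := fun y => fderiv ℝ (radialExt u) y v) fun x => ?_
  exact ((hu.contDiffAt_radialExt (ne_zero x)).fderiv_right (m := ∞) (by simp)).clm_apply
    contDiffAt_const

/-- The differential of a map that is constant along rays is homogeneous of degree `-1`. -/
lemma radialExt_tderiv (u : S2 → F) {y : E3} (hy : y ≠ 0) (v : E3) :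
    radialExt (fun x => tderiv u x v) y = ‖y‖ • fderiv ℝ (radialExt u) y v := by
  have hy' : 0 < ‖y‖ := norm_pos_iff.2 hy
  rw [radialExt, dif_pos hy]
  simp only [tderiv]
  have h : (fun z => radialExt u (‖y‖⁻¹ • z)) = radialExt u :=
    funext fun z => radialExt_smul u (inv_pos.2 hy') z
  have h2 := fderiv_comp_smul (𝕜 := ℝ) (f := radialExt u) (x := y) (‖y‖⁻¹)
  rw [h] at h2
  rw [h2, smul_apply, smul_smul, mul_inv_cancel₀ hy'.ne', one_smul]

/-- The differential vanishes on the normal vector, because the radial extension is constant along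
rays. -/
lemma tderiv_self {u : S2 → F} (hu : IsSmooth u) (x : S2) : tderiv u x x = 0 := by
  have h1 : HasDerivAt (fun t : ℝ => radialExt u ((x : E3) + t • (x : E3)))
      (fderiv ℝ (radialExt u) x x) 0 := by
    have h2 : HasDerivAt (fun t : ℝ => (x : E3) + t • (x : E3)) (x : E3) 0 := by
      simpa using ((hasDerivAt_id (0 : ℝ)).smul_const (x : E3)).const_add (x : E3)
    have h3 : HasFDerivAt (radialExt u) (fderiv ℝ (radialExt u) x) ((x : E3) + (0 : ℝ) • (x : E3)) := by
      simpa using (hu.differentiableAt_radialExt (ne_zero x)).hasFDerivAt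
    exact h3.comp_hasDerivAt 0 h2
  have h4 : (fun t : ℝ => radialExt u ((x : E3) + t • (x : E3))) =ᶠ[𝓝 0] fun _ => u x := by
    filter_upwards [lt_mem_nhds (show (-1 : ℝ) < 0 by norm_num)] with t ht
    have : (x : E3) + t • (x : E3) = (1 + t) • (x : E3) := by rw [add_smul, one_smul]
    rw [this, radialExt_smul u (by linarith), radialExt_coe]
  exact h1.unique ((hasDerivAt_const 0 (u x)).congr_of_eventuallyEq h4)

lemma tderiv_add {u v : S2 → F} (hu : IsSmooth u) (hv : IsSmooth v) (x : S2) :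
    tderiv (u + v) x = tderiv u x + tderiv v x := by
  have h : radialExt (u + v) = fun y => radialExt u y + radialExt v y := by
    ext y; by_cases hy : y = 0 <;> simp [radialExt, hy]
  rw [tderiv, h, fderiv_fun_add (hu.differentiableAt_radialExt (ne_zero x))
    (hv.differentiableAt_radialExt (ne_zero x))]
  rfl

lemma tderiv_smul (c : ℝ) {u : S2 → F} (hu : IsSmooth u) (x : S2) :
    tderiv (c • u) x = c • tderiv u x := by
  have h : radialExt (c • u) = fun y => c • radialExt u y := by
    ext y; by_cases hy : y = 0 <;> simp [radialExt, hy]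
  rw [tderiv, h, fderiv_fun_const_smul (hu.differentiableAt_radialExt (ne_zero x))]
  rfl

lemma tderiv_mul {u v : S2 → ℝ} (hu : IsSmooth u) (hv : IsSmooth v) (x : S2) :
    tderiv (u * v) x = u x • tderiv v x + v x • tderiv u x := by
  have h : radialExt (u * v) = fun y => radialExt u y * radialExt v y := by
    ext y; by_cases hy : y = 0 <;> simp [radialExt, hy]
  rw [tderiv, h, fderiv_fun_mul (hu.differentiableAt_radialExt (ne_zero x))
    (hv.differentiableAt_radialExt (ne_zero x)), radialExt_coe, radialExt_coe]
  rfl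

/-! ### The ring of smooth functions and the tangential derivations -/

/-- The ring of smooth real functions on `S²`. -/
abbrev SmoothFun := C^∞⟮𝓡 2, S2; 𝓘(ℝ, ℝ), ℝ⟯

lemma SmoothFun.isSmooth (u : SmoothFun) : IsSmooth (u : S2 → ℝ) := u.contMDiff

/-- The derivation `δ_i = (e_i - x_i x) · ∂` of the ring of smooth functions: the derivative in the
direction of the tangential part of the `i`-th basis vector. -/
def tanDeriv (i : Fin 3) : Derivation ℝ SmoothFun SmoothFun :=
  Derivation.mk'
    { toFun := fun u => ⟨fun x => tderiv u x (e i), u.isSmooth.tderiv_apply (e i)⟩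
      map_add' := fun u v => ContMDiffMap.ext fun x =>
        DFunLike.congr_fun (tderiv_add u.isSmooth v.isSmooth x) (e i)
      map_smul' := fun c u => ContMDiffMap.ext fun x =>
        DFunLike.congr_fun (tderiv_smul c u.isSmooth x) (e i) }
    fun u v => ContMDiffMap.ext fun x =>
      DFunLike.congr_fun (tderiv_mul u.isSmooth v.isSmooth x) (e i)

lemma tanDeriv_apply (i : Fin 3) (u : SmoothFun) (x : S2) :
    tanDeriv i u x = tderiv u x (e i) := rfl

/-- The coordinate function `X^i` on `S²`. -/
def coord (i : Fin 3) : SmoothFun :=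
  ⟨fun x => (x : E3) i, isSmooth_restrict (U := fun y => y i) fun x => by fun_prop⟩

@[simp] lemma coord_apply (i : Fin 3) (x : S2) : coord i x = (x : E3) i := rfl

lemma sum_coord_sq : coord 0 ^ 2 + coord 1 ^ 2 + coord 2 ^ 2 = 1 := by
  ext x
  have h : ‖(x : E3)‖ ^ 2 = 1 := by simp
  rw [EuclideanSpace.real_norm_sq_eq, Fin.sum_univ_three] at h
  simpa using h

lemma eq_sum_e (v : E3) : v = ∑ i, v i • e i := by
  ext j
  simp [e, Finset.sum_apply, Pi.single_apply]

lemma sum_coord_mul_tanDeriv (u : SmoothFun) :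
    coord 0 * tanDeriv 0 u + coord 1 * tanDeriv 1 u + coord 2 * tanDeriv 2 u = 0 := by
  ext x
  have h := tderiv_self u.isSmooth x
  have h2 : tderiv (⇑u) x (x : E3) = tderiv (⇑u) x (∑ i, (x : E3) i • e i) := by
    rw [← eq_sum_e]
  rw [h2] at h
  simpa [Fin.sum_univ_three, tanDeriv_apply] using h

lemma hasFDerivAt_norm (x : S2) :
    HasFDerivAt (fun y : E3 => ‖y‖) (innerSL ℝ (x : E3)) (x : E3) := by
  have h := (hasStrictFDerivAt_norm_sq (x : E3)).hasFDerivAt.sqrt (by simp)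
  simp only [Real.sqrt_sq (norm_nonneg _)] at h
  refine h.congr_fderiv ?_
  ext v
  simp

lemma inner_e (v : E3) (i : Fin 3) : inner ℝ v (e i) = v i := by
  simp [e, EuclideanSpace.inner_single_right]

lemma tanDeriv_coord (i j : Fin 3) :
    tanDeriv i (coord j) = (if i = j then 1 else 0) - coord i * coord j := by
  ext x
  have h : radialExt (coord j) =ᶠ[𝓝 (x : E3)] fun y => ‖y‖⁻¹ * y j := by
    filter_upwards [isOpen_ne.mem_nhds (ne_zero x)] with y hy
    have hy' : y ≠ 0 := hy
    simp [radialExt, hy']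
  have hx1 : ‖(x : E3)‖ = 1 := by simp
  have h1 : HasFDerivAt (fun y : E3 => ‖y‖⁻¹) (-(‖(x : E3)‖ ^ 2)⁻¹ • innerSL ℝ (x : E3)) (x : E3) :=
    (hasDerivAt_inv (by simp : ‖(x : E3)‖ ≠ 0)).comp_hasFDerivAt _ (hasFDerivAt_norm x)
  have h2 : HasFDerivAt (fun y : E3 => y j) (EuclideanSpace.proj j : E3 →L[ℝ] ℝ) (x : E3) :=
    (EuclideanSpace.proj j : E3 →L[ℝ] ℝ).hasFDerivAt
  rw [tanDeriv_apply, tderiv, h.fderiv_eq, (h1.fun_mul h2).fderiv]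
  have h3 : (e i) j = if i = j then (1 : ℝ) else 0 := by
    simp [e, eq_comm]
  have h4 : ((if i = j then 1 else 0 : SmoothFun) : S2 → ℝ) x = if i = j then (1 : ℝ) else 0 := by
    split_ifs <;> rfl
  rw [ContMDiffMap.coe_sub, Pi.sub_apply, h4, ← h3]
  simp [hx1, inner_e]
  ring

/-- The second tangential derivatives in terms of the Hessian of the radial extension. -/
lemma tanDeriv_tanDeriv_apply (i j : Fin 3) (u : SmoothFun) (x : S2) :
    tanDeriv i (tanDeriv j u) x = coord i x * tanDeriv j u x +
      fderiv ℝ (fderiv ℝ (radialExt u)) x (e i) (e j) := by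
  have h : radialExt (tanDeriv j u) =ᶠ[𝓝 (x : E3)]
      fun y => ‖y‖ * fderiv ℝ (radialExt u) y (e j) := by
    filter_upwards [isOpen_ne.mem_nhds (ne_zero x)] with y hy
    exact radialExt_tderiv u hy (e j)
  have hd : DifferentiableAt ℝ (fderiv ℝ (radialExt u)) (x : E3) :=
    ((u.isSmooth.contDiffAt_radialExt (ne_zero x)).fderiv_right (m := ∞)
      (by simp)).differentiableAt (by simp)
  have h2 : HasFDerivAt (fun y => fderiv ℝ (radialExt u) y (e j))
      ((fderiv ℝ (fderiv ℝ (radialExt u)) x).flip (e j)) (x : E3) :=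
    hd.hasFDerivAt.clm_apply (hasFDerivAt_const (e j) _) |>.congr_fderiv (by ext; simp)
  rw [tanDeriv_apply, tderiv, h.fderiv_eq, ((hasFDerivAt_norm x).fun_mul h2).fderiv]
  simp [inner_e, tanDeriv_apply, tderiv]
  ring

/-- The commutator of the tangential derivations. -/
lemma tanDeriv_comm (i j : Fin 3) (u : SmoothFun) :
    tanDeriv i (tanDeriv j u) =
      tanDeriv j (tanDeriv i u) + coord i * tanDeriv j u - coord j * tanDeriv i u := by
  ext x
  have h : fderiv ℝ (fderiv ℝ (radialExt u)) x (e i) (e j) =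
      fderiv ℝ (fderiv ℝ (radialExt u)) x (e j) (e i) :=
    ((u.isSmooth.contDiffAt_radialExt (ne_zero x)).isSymmSndFDerivAt
      (by simpa using (WithTop.coe_le_coe.2 le_top : ((2 : ℕ∞) : ℕ∞ω) ≤ ∞))) (e i) (e j)
  have h1 := tanDeriv_tanDeriv_apply i j u x
  have h2 := tanDeriv_tanDeriv_apply j i u x
  simp only [ContMDiffMap.coe_sub, ContMDiffMap.coe_add, ContMDiffMap.coe_mul, Pi.sub_apply,
    Pi.add_apply, Pi.mul_apply]
  rw [h1, h2, h]
  ring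

/-! ### The maximum principle and harmonic functions -/

lemma SmoothFun.eq_const_of_tanDeriv_eq_zero {u : SmoothFun} (h : ∀ i, tanDeriv i u = 0) :
    ∃ c : ℝ, ∀ x, u x = c := by
  have hc : IsPreconnected ({0}ᶜ : Set E3) :=
    (isConnected_compl_singleton_of_one_lt_rank (by
      rw [← Module.finrank_eq_rank, finrank_euclideanSpace_fin]; norm_num) 0).isPreconnected
  obtain ⟨c, hc⟩ := isOpen_compl_singleton.exists_is_const_of_fderiv_eq_zero hc (𝕜 := ℝ)
    (f := radialExt u)
    (fun y hy => (u.isSmooth.differentiableAt_radialExt hy).differentiableWithinAt) (by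
      intro y hy
      have hy : y ≠ 0 := hy
      have h1 : ∀ i, fderiv ℝ (radialExt u) y (e i) = 0 := fun i => by
        have h2 := radialExt_tderiv u hy (e i)
        have h3 : radialExt (fun x => tderiv u x (e i)) y = 0 := by
          rw [radialExt, dif_pos hy]
          exact DFunLike.congr_fun (h i) _
        rw [h3] at h2
        exact (smul_eq_zero.1 h2.symm).resolve_left (norm_ne_zero_iff.2 hy)
      ext v
      rw [eq_sum_e v, map_sum]
      simp [h1])
  exact ⟨c, fun x => by rw [← hc x (ne_zero x), radialExt_coe]⟩

/-- The Laplacian on smooth functions, `Δ = δ_0² + δ_1² + δ_2²`. -/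
def lap (u : SmoothFun) : SmoothFun :=
  tanDeriv 0 (tanDeriv 0 u) + tanDeriv 1 (tanDeriv 1 u) + tanDeriv 2 (tanDeriv 2 u)

lemma deriv_deriv_nonpos_of_isLocalMax {g : ℝ → ℝ} {a : ℝ} (hg : ContinuousAt g a)
    (h : IsLocalMax g a) : deriv (deriv g) a ≤ 0 := by
  by_contra! hpos
  have h1 := isLocalMin_of_deriv_deriv_pos hpos h.deriv_eq_zero hg
  have h2 : g =ᶠ[𝓝 a] fun _ => g a := by
    filter_upwards [h, h1] with t ht1 ht2 using le_antisymm ht1 ht2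
  have h3 : deriv (deriv g) a = 0 := by
    rw [h2.deriv.deriv_eq]; simp
  exact hpos.ne' h3

/-- At a maximum of `w` the radial extension of `w` is maximal as well, so its second derivatives along
the coordinate axes are nonpositive. -/
lemma lap_nonpos_of_isMax {w : SmoothFun} {x : S2} (h : ∀ y, w y ≤ w x) : lap w x ≤ 0 := by
  have hs := DFunLike.congr_fun (sum_coord_mul_tanDeriv w) x
  have key : ∀ i, fderiv ℝ (fderiv ℝ (radialExt w)) x (e i) (e i) ≤ 0 := fun i => by
    let c : ℝ → E3 := fun t => (x : E3) + t • e i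
    have hcd : ∀ t, HasDerivAt c (e i) t := fun t => by
      simpa [c] using ((hasDerivAt_id t).smul_const (e i)).const_add (x : E3)
    have hc0 : c 0 = x := by simp [c]
    have hne : ∀ᶠ t in 𝓝 0, c t ≠ 0 := by
      refine (hcd 0).continuousAt.eventually_ne ?_
      rw [hc0]; exact ne_zero x
    have hdiff : ∀ t, c t ≠ 0 → HasDerivAt (fun t => radialExt w (c t))
        (fderiv ℝ (radialExt w) (c t) (e i)) t := fun t ht =>
      (w.isSmooth.differentiableAt_radialExt ht).hasFDerivAt.comp_hasDerivAt t (hcd t)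
    have hd : DifferentiableAt ℝ (fderiv ℝ (radialExt w)) (c 0) := by
      rw [hc0]
      exact ((w.isSmooth.contDiffAt_radialExt (ne_zero x)).fderiv_right (m := ∞)
        (by simp)).differentiableAt (by simp)
    have hdd : HasDerivAt (fun t => fderiv ℝ (radialExt w) (c t) (e i))
        (fderiv ℝ (fderiv ℝ (radialExt w)) (c 0) (e i) (e i)) 0 := by
      have := (hd.hasFDerivAt.comp_hasDerivAt 0 (hcd 0)).clm_apply (hasDerivAt_const 0 (e i))
      simpa using this
    have hmax : IsLocalMax (fun t => radialExt w (c t)) 0 := by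
      filter_upwards [hne] with t ht
      simp only [hc0]
      rw [radialExt_coe, radialExt, dif_pos ht]
      exact h _
    have := deriv_deriv_nonpos_of_isLocalMax
      (hdiff 0 (by rw [hc0]; exact ne_zero x)).continuousAt hmax
    have h2 : deriv (fun t => radialExt w (c t)) =ᶠ[𝓝 0]
        fun t => fderiv ℝ (radialExt w) (c t) (e i) := by
      filter_upwards [hne] with t ht using (hdiff t ht).deriv
    rwa [h2.deriv_eq, hdd.deriv, hc0] at this
  simp only [ContMDiffMap.coe_add, ContMDiffMap.coe_mul, Pi.add_apply, Pi.mul_apply,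
    ContMDiffMap.coe_zero, Pi.zero_apply] at hs
  simp only [lap, ContMDiffMap.coe_add, Pi.add_apply, tanDeriv_tanDeriv_apply]
  linarith [key 0, key 1, key 2]

end

@[simp] lemma SmoothFun.two_apply (x : S2) : (2 : SmoothFun) x = 2 := by
  have h : (2 : SmoothFun) = 1 + 1 := one_add_one_eq_two.symm
  rw [h, ContMDiffMap.coe_add, Pi.add_apply, ContMDiffMap.coe_one, Pi.one_apply]
  norm_num

lemma lap_add (u v : SmoothFun) : lap (u + v) = lap u + lap v := by
  simp only [lap, map_add]; ring

lemma lap_neg (u : SmoothFun) : lap (-u) = -lap u := by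
  simp only [lap, map_neg]; ring

lemma lap_sub (u v : SmoothFun) : lap (u - v) = lap u - lap v := by
  simp only [lap, map_sub]; ring

lemma lap_mul (u v : SmoothFun) :
    lap (u * v) = u * lap v + v * lap u + 2 * (tanDeriv 0 u * tanDeriv 0 v +
      tanDeriv 1 u * tanDeriv 1 v + tanDeriv 2 u * tanDeriv 2 v) := by
  simp only [lap, map_add, Derivation.leibniz, smul_eq_mul]; ring

lemma lap_coord (j : Fin 3) : lap (coord j) = -2 * coord j := by
  have h := sum_coord_sq
  fin_cases j <;> simp [lap, tanDeriv_coord, Derivation.leibniz]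
  · linear_combination 2 * coord 0 * h
  · linear_combination 2 * coord 1 * h
  · linear_combination 2 * coord 2 * h

lemma sum_coord_mul_tanDeriv_tanDeriv (j : Fin 3) (u : SmoothFun) :
    coord 0 * tanDeriv j (tanDeriv 0 u) + coord 1 * tanDeriv j (tanDeriv 1 u) +
      coord 2 * tanDeriv j (tanDeriv 2 u) = -tanDeriv j u := by
  have h := congrArg (tanDeriv j) (sum_coord_mul_tanDeriv u)
  have h2 := sum_coord_mul_tanDeriv u
  simp only [map_add, Derivation.leibniz, smul_eq_mul, tanDeriv_coord, map_zero] at h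
  fin_cases j <;> simp at h ⊢
  · linear_combination h + coord 0 * h2
  · linear_combination h + coord 1 * h2
  · linear_combination h + coord 2 * h2

/-- The commutator `[Δ, δ_j] = -2 x_j Δ`. -/
lemma lap_tanDeriv (j : Fin 3) (u : SmoothFun) :
    lap (tanDeriv j u) = tanDeriv j (lap u) - 2 * coord j * lap u := by
  have h1 := fun i => congrArg (tanDeriv i) (tanDeriv_comm i j u)
  have h2 := fun i => tanDeriv_comm i j (tanDeriv i u)
  have h3 := sum_coord_mul_tanDeriv_tanDeriv j u
  have h4 := sum_coord_mul_tanDeriv u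
  have h5 := sum_coord_mul_tanDeriv (tanDeriv j u)
  have h6 := sum_coord_sq
  simp only [map_add, map_sub, Derivation.leibniz, smul_eq_mul, tanDeriv_coord] at h1
  simp only [lap, map_add]
  have h10 := h1 0
  have h11 := h1 1
  have h12 := h1 2
  have h20 := h2 0
  have h21 := h2 1
  have h22 := h2 2
  fin_cases j <;> simp at h10 h11 h12 h20 h21 h22 h3 h4 h5 ⊢
  · linear_combination h11 + h12 + h21 + h22 + h3 + h5 + coord 0 * h4 - tanDeriv 0 u * h6
  · linear_combination h10 + h12 + h20 + h22 + h3 + h5 + coord 1 * h4 - tanDeriv 1 u * h6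
  · linear_combination h10 + h11 + h20 + h21 + h3 + h5 + coord 2 * h4 - tanDeriv 2 u * h6

/-- The Laplacian commutes with the infinitesimal rotations. -/
lemma lap_rotation (k i : Fin 3) (u : SmoothFun) :
    lap (coord k * tanDeriv i u - coord i * tanDeriv k u) =
      coord k * tanDeriv i (lap u) - coord i * tanDeriv k (lap u) := by
  have h : ∀ k i, lap (coord k * tanDeriv i u) = coord k * tanDeriv i (lap u)
      - 2 * coord k * coord i * lap u - 2 * coord k * tanDeriv i u
      + 2 * tanDeriv k (tanDeriv i u) := fun k i => by
    have h1 := sum_coord_mul_tanDeriv (tanDeriv i u)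
    rw [lap_mul, lap_coord, lap_tanDeriv]
    simp only [tanDeriv_coord]
    fin_cases k <;> simp
    · linear_combination (-2 * coord 0) * h1
    · linear_combination (-2 * coord 1) * h1
    · linear_combination (-2 * coord 2) * h1
  have hc := tanDeriv_comm k i u
  rw [lap_sub, h, h]
  linear_combination 2 * hc

/-- A harmonic function on the sphere is constant. At a maximum of `|∇v|²` the Bochner identity
`Δ|∇v|² = 2 Σ (δ_i δ_j v)²` forces all `δ_i δ_j v` to vanish, and then so does
`δ_i v = -Σ_j x_j δ_i δ_j v`. -/
lemma eq_const_of_lap_eq_zero {v : SmoothFun} (hv : lap v = 0) : ∃ c : ℝ, ∀ x, v x = c := by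
  set w : SmoothFun := tanDeriv 0 v * tanDeriv 0 v + tanDeriv 1 v * tanDeriv 1 v
    + tanDeriv 2 v * tanDeriv 2 v with hw
  have : Nonempty S2 := ⟨⟨e 0, by simp [e]⟩⟩
  obtain ⟨x, -, hx⟩ := isCompact_univ.exists_isMaxOn Set.univ_nonempty
    (w.contMDiff.continuous.continuousOn)
  have hmax : ∀ y, w y ≤ w x := fun y => hx (Set.mem_univ y)
  have h1 := lap_nonpos_of_isMax hmax
  have h2 : ∀ j, lap (tanDeriv j v) = 0 := fun j => by rw [lap_tanDeriv, hv]; simp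
  have h3 : lap w x = 2 * ∑ i, ∑ j, (tanDeriv i (tanDeriv j v) x) ^ 2 := by
    have : lap w = 2 * ∑ i, ∑ j, (tanDeriv i (tanDeriv j v)) ^ 2 := by
      rw [hw, lap_add, lap_add, lap_mul, lap_mul, lap_mul, h2, h2, h2]
      simp only [Fin.sum_univ_three]
      ring
    rw [this]
    simp [Fin.sum_univ_three]
  have h4 : ∀ i j, tanDeriv i (tanDeriv j v) x = 0 := by
    have h5 : ∑ i, ∑ j, (tanDeriv i (tanDeriv j v) x) ^ 2 = 0 :=
      le_antisymm (by linarith) (by positivity)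
    intro i j
    have h6 := (Finset.sum_eq_zero_iff_of_nonneg (fun i _ => by positivity)).1 h5 i (by simp)
    have h7 := (Finset.sum_eq_zero_iff_of_nonneg (fun i _ => by positivity)).1 h6 j (by simp)
    exact pow_eq_zero_iff (two_ne_zero) |>.1 h7
  have h8 : ∀ j, tanDeriv j v x = 0 := fun j => by
    have := DFunLike.congr_fun (sum_coord_mul_tanDeriv_tanDeriv j v) x
    simp only [ContMDiffMap.coe_add, ContMDiffMap.coe_mul, ContMDiffMap.coe_neg, Pi.add_apply,
      Pi.mul_apply, Pi.neg_apply, h4] at this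
    linarith
  have h9 : ∀ y, w y = tanDeriv 0 v y ^ 2 + tanDeriv 1 v y ^ 2 + tanDeriv 2 v y ^ 2 := fun y => by
    rw [hw]
    simp only [ContMDiffMap.coe_add, ContMDiffMap.coe_mul, Pi.add_apply, Pi.mul_apply]
    ring
  refine SmoothFun.eq_const_of_tanDeriv_eq_zero fun i => ContMDiffMap.ext fun y => ?_
  have h10 := hmax y
  rw [h9, h9, h8, h8, h8] at h10
  have hi : tanDeriv i v y ^ 2 ≤ 0 := by
    fin_cases i <;> simp <;>
      nlinarith [sq_nonneg (tanDeriv 0 v y), sq_nonneg (tanDeriv 1 v y), sq_nonneg (tanDeriv 2 v y)]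
  exact pow_eq_zero_iff (two_ne_zero) |>.1 (le_antisymm hi (sq_nonneg _))

/-- The linear function `b · x` as an element of the ring of smooth functions. -/
def linFun (b : E3) : SmoothFun := b 0 • coord 0 + b 1 • coord 1 + b 2 • coord 2

lemma coordFun_eq (b : E3) : coordFun b = linFun b := by
  ext x
  simp [coordFun, linFun, PiLp.inner_apply, Fin.sum_univ_three]
  ring

lemma lap_linFun (b : E3) : lap (linFun b) = -2 * linFun b := by
  have h : ∀ (c : ℝ) u, lap (c • u) = c • lap u := fun c u => by simp [lap]
  simp only [linFun, lap_add, h, lap_coord, mul_add, mul_smul_comm]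

/-- The eigenfunctions of the Laplacian for the eigenvalue `-2` are the linear functions: the
functions `δ_j w + x_j w` are harmonic, hence equal to constants `b_j`, and
`w = Σ x_j (δ_j w + x_j w)`. -/
lemma eq_linFun_of_lap {w : SmoothFun} (hw : lap w + 2 * w = 0) : ∃ b : E3, w = linFun b := by
  have h1 : ∀ j, lap (tanDeriv j w + coord j * w) = 0 := fun j => by
    have h2 := congrArg (tanDeriv j) hw
    simp only [map_add, Derivation.leibniz, smul_eq_mul, map_zero] at h2
    have h2' : tanDeriv j (2 : SmoothFun) = 0 := by
      simpa using (tanDeriv j).map_natCast 2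
    rw [h2'] at h2
    have hs := sum_coord_mul_tanDeriv w
    rw [lap_add, lap_tanDeriv, lap_mul, lap_coord]
    simp only [tanDeriv_coord]
    fin_cases j <;> simp at h2 ⊢
    · linear_combination h2 - coord 0 * hw - 2 * coord 0 * hs
    · linear_combination h2 - coord 1 * hw - 2 * coord 1 * hs
    · linear_combination h2 - coord 2 * hw - 2 * coord 2 * hs
  choose c hc using fun j => eq_const_of_lap_eq_zero (h1 j)
  refine ⟨WithLp.toLp 2 c, ContMDiffMap.ext fun x => ?_⟩
  have hs := DFunLike.congr_fun (sum_coord_mul_tanDeriv w) x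
  have hq := DFunLike.congr_fun sum_coord_sq x
  have hc0 := hc 0 x
  have hc1 := hc 1 x
  have hc2 := hc 2 x
  simp [linFun, pow_two] at hs hq hc0 hc1 hc2 ⊢
  linear_combination (x : E3) 0 * hc0 + (x : E3) 1 * hc1 + (x : E3) 2 * hc2 - hs - w x * hq

section

/-! ### The Cauchy transform in the plane -/

open MeasureTheory Complex

lemma integrableOn_polar {A : ℝ × ℝ → ℂ} (hA : Continuous A) {R : ℝ}
    (hR : ∀ p : ℝ × ℝ, R < p.1 → A p = 0) :
    IntegrableOn A (Set.Ioi 0 ×ˢ Set.Ioo (-Real.pi) Real.pi) := by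
  have h1 : IntegrableOn A (Set.Icc 0 R ×ˢ Set.Icc (-Real.pi) Real.pi) :=
    hA.continuousOn.integrableOn_compact (isCompact_Icc.prod isCompact_Icc)
  refine h1.of_forall_sdiff_eq_zero (measurableSet_Ioi.prod measurableSet_Ioo) ?_
  rintro ⟨r, θ⟩ ⟨⟨hr, hθ⟩, h⟩
  refine hR _ (not_le.1 fun hle => h ⟨⟨le_of_lt hr, hle⟩, Set.Ioo_subset_Icc_self hθ⟩)

/-- The Cauchy–Pompeiu formula for functions of compact support. In polar coordinates
`ζ = r e^{iθ}` the integrand is `∂_r h + (i / r) ∂_θ h`: the first term integrates along rays, the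
second one integrates to zero along circles. -/
lemma integral_inv_mul_dbar {h : ℂ → ℂ} (hh : ContDiff ℝ 1 h) (hc : HasCompactSupport h) :
    ∫ ζ : ℂ, ζ⁻¹ * (fderiv ℝ h ζ 1 + I * fderiv ℝ h ζ I) = -(2 * Real.pi) * h 0 := by
  obtain ⟨R, hRpos, hR⟩ := hc.isCompact.isBounded.exists_pos_norm_lt
  have hzero : ∀ z, R ≤ ‖z‖ → h z = 0 := fun z hz =>
    image_eq_zero_of_notMem_tsupport fun hm => absurd (hR z hm) (not_lt.2 hz)
  have hzero' : ∀ z, R ≤ ‖z‖ → fderiv ℝ h z = 0 := fun z hz =>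
    image_eq_zero_of_notMem_tsupport fun hm => absurd (hR z (tsupport_fderiv_subset ℝ hm)) (not_lt.2 hz)
  have hd : ∀ z, HasFDerivAt h (fderiv ℝ h z) z := fun z =>
    (hh.differentiable one_ne_zero z).hasFDerivAt
  have hcont : Continuous (fderiv ℝ h) := hh.continuous_fderiv one_ne_zero
  let P : ℝ × ℝ → ℂ := fun p => p.1 * exp (p.2 * I)
  let A : ℝ × ℝ → ℂ := fun p => fderiv ℝ h (P p) (exp (p.2 * I))
  let B : ℝ × ℝ → ℂ := fun p => fderiv ℝ h (P p) (I * exp (p.2 * I))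
  have hPc : Continuous P := by fun_prop
  have hAc : Continuous A := (hcont.comp hPc).clm_apply (by fun_prop)
  have hBc : Continuous B := (hcont.comp hPc).clm_apply (by fun_prop)
  have hPn : ∀ p, ‖P p‖ = |p.1| := fun p => by simp [P, norm_exp_ofReal_mul_I]
  have hPz : ∀ p : ℝ × ℝ, R < p.1 → fderiv ℝ h (P p) = 0 := fun p hp =>
    hzero' _ (by rw [hPn]; exact hp.le.trans (le_abs_self _))
  have hAi := integrableOn_polar hAc (R := R) (fun p hp => by simp [A, hPz p hp])
  have hBi := integrableOn_polar hBc (R := R) (fun p hp => by simp [B, hPz p hp])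
  have hAint : ∫ p in Set.Ioi 0 ×ˢ Set.Ioo (-Real.pi) Real.pi, A p = -(2 * Real.pi) * h 0 := by
    rw [Measure.volume_eq_prod, ← setIntegral_prod_swap, setIntegral_prod _ (by
      have := hAi.swap
      exact this)]
    have h1 : ∀ θ : ℝ, ∫ r in Set.Ioi (0 : ℝ), A (r, θ) = -h 0 := fun θ => by
      have hF : ContDiff ℝ 1 (fun r : ℝ => h (r * exp (θ * I))) :=
        hh.comp (ofRealCLM.contDiff.mul contDiff_const)
      have hFd : ∀ r : ℝ, HasDerivAt (fun r : ℝ => h (r * exp (θ * I))) (A (r, θ)) r := fun r => by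
        have h2 : HasDerivAt (fun r : ℝ => (r : ℂ) * exp (θ * I)) (exp (θ * I)) r := by
          simpa using (ofRealCLM.hasDerivAt (x := r)).mul_const (exp (θ * I))
        exact (hd _).comp_hasDerivAt r h2
      have hFc : HasCompactSupport (fun r : ℝ => h (r * exp (θ * I))) := by
        refine HasCompactSupport.intro (isCompact_Icc (a := -R) (b := R)) fun r hr => hzero _ ?_
        rw [norm_mul, norm_exp_ofReal_mul_I, mul_one, norm_real, Real.norm_eq_abs]
        by_contra! hlt
        exact hr (abs_le.1 hlt.le)
      have := hFc.integral_Ioi_deriv_eq hF 0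
      simpa [(hFd _).deriv] using this
    simp only [Prod.swap_prod_mk, h1]
    simp only [integral_const, measureReal_restrict_apply_univ, Real.volume_real_Ioo, real_smul]
    rw [max_eq_left (by linarith [Real.pi_pos])]
    push_cast
    ring
  have hBint : ∫ p in Set.Ioi 0 ×ˢ Set.Ioo (-Real.pi) Real.pi, B p = 0 := by
    rw [Measure.volume_eq_prod, setIntegral_prod _ hBi]
    refine setIntegral_eq_zero_of_forall_eq_zero fun r hr => ?_
    have hr : (0 : ℝ) < r := hr
    have hFd : ∀ θ : ℝ, HasDerivAt (fun θ : ℝ => (r : ℂ)⁻¹ * h (r * exp (θ * I))) (B (r, θ)) θ :=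
      fun θ => by
        have h2 : HasDerivAt (fun θ : ℝ => (r : ℂ) * exp (θ * I)) (r • (I * exp (θ * I))) θ := by
          have h3 : HasDerivAt (fun θ : ℝ => (θ : ℂ) * I) I θ := by
            simpa using (ofRealCLM.hasDerivAt (x := θ)).mul_const I
          have := (h3.cexp).const_mul (r : ℂ)
          simpa [mul_comm] using this
        have h4 := ((hd _).comp_hasDerivAt θ h2).const_mul (r : ℂ)⁻¹
        refine h4.congr_deriv ?_
        have hr' : (r : ℂ) ≠ 0 := by exact_mod_cast hr.ne'
        rw [map_smul, real_smul]
        simp only [B, P]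
        field_simp
    rw [← integral_Ioc_eq_integral_Ioo, ← intervalIntegral.integral_of_le
      (by linarith [Real.pi_pos]), intervalIntegral.integral_eq_sub_of_hasDerivAt
      (fun θ _ => hFd θ) ((hBc.comp (by fun_prop)).intervalIntegrable _ _)]
    simp [exp_neg]
  rw [← Complex.integral_comp_polarCoord_symm, polarCoord_target]
  have hAB : ∀ p ∈ Set.Ioi (0 : ℝ) ×ˢ Set.Ioo (-Real.pi) Real.pi,
      p.1 • ((Complex.polarCoord.symm p)⁻¹ * (fderiv ℝ h (Complex.polarCoord.symm p) 1 +
        I * fderiv ℝ h (Complex.polarCoord.symm p) I)) = A p + I * B p := by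
    rintro ⟨r, θ⟩ ⟨hr, -⟩
    have hr : (0 : ℝ) < r := hr
    have hr' : (r : ℂ) ≠ 0 := by exact_mod_cast hr.ne'
    have hP : Complex.polarCoord.symm (r, θ) = P (r, θ) := by
      simp [P, exp_mul_I]
    have he : exp (θ * I) = (Real.cos θ) • (1 : ℂ) + (Real.sin θ) • I := by
      simp [exp_mul_I]
    have hie : I * exp (θ * I) = (-Real.sin θ) • (1 : ℂ) + (Real.cos θ) • I := by
      rw [he]; simp only [real_smul, ofReal_neg]; linear_combination (Real.sin θ : ℂ) * I_mul_I
    have hA' : A (r, θ) = Real.cos θ * fderiv ℝ h (P (r, θ)) 1 +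
        Real.sin θ * fderiv ℝ h (P (r, θ)) I := by
      simp only [A, he]
      rw [map_add, map_smul, map_smul, real_smul, real_smul]
    have hB' : B (r, θ) = -Real.sin θ * fderiv ℝ h (P (r, θ)) 1 +
        Real.cos θ * fderiv ℝ h (P (r, θ)) I := by
      simp only [B, hie]
      rw [map_add, map_smul, map_smul, real_smul, real_smul, ofReal_neg]
    have hinv : (P (r, θ))⁻¹ = (r : ℂ)⁻¹ * (Real.cos θ - Real.sin θ * I) := by
      simp only [P]
      rw [mul_inv, ← exp_neg, ← neg_mul, ← ofReal_neg, exp_mul_I]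
      simp [sub_eq_add_neg]
    rw [hP, hA', hB', hinv, real_smul]
    field_simp
    linear_combination (-Real.sin θ * fderiv ℝ h (P (r, θ)) I) * I_sq
  rw [setIntegral_congr_fun (measurableSet_Ioi.prod measurableSet_Ioo) hAB,
    integral_add hAi (hBi.const_mul I), integral_const_mul, hAint, hBint]
  simp

lemma locallyIntegrable_inv : LocallyIntegrable (fun ζ : ℂ => ζ⁻¹) := by
  refine locallyIntegrable_of_norm_le_rpow (C := 1) (α := 1) (by simp) (by simp)
    (Eventually.of_forall fun ζ => ?_) (by fun_prop)
  simp [Real.rpow_neg_one]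

/-- The inhomogeneous Cauchy–Riemann equation `(∂_x + i ∂_y) v = g` with a right-hand side of
compact support has a smooth solution that tends to zero at infinity. -/
lemma exists_dbar {g : ℂ → ℂ} (hg : ContDiff ℝ ∞ g) (hc : HasCompactSupport g) :
    ∃ v : ℂ → ℂ, ContDiff ℝ ∞ v ∧ (∀ z, fderiv ℝ v z 1 + I * fderiv ℝ v z I = g z) ∧
      Tendsto v (cocompact ℂ) (𝓝 0) := by
  let L := ContinuousLinearMap.mul ℝ ℂ
  let c : ℂ := (2 * Real.pi)⁻¹
  have hcπ : c * (2 * Real.pi) = 1 := by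
    have : (Real.pi : ℂ) ≠ 0 := by exact_mod_cast Real.pi_ne_zero
    simp only [c]; field_simp
  let w : ℂ → ℂ := convolution (fun ζ : ℂ => ζ⁻¹) g L volume
  have hg1 : ContDiff ℝ 1 g := hg.of_le (by exact_mod_cast le_top)
  have hw : ContDiff ℝ ∞ w :=
    hc.contDiff_convolution_right (n := ⊤) L locallyIntegrable_inv hg
  have hwd : ∀ z y, fderiv ℝ w z y = ∫ ζ : ℂ, ζ⁻¹ * fderiv ℝ g (z - ζ) y := fun z y => by
    rw [(hc.hasFDerivAt_convolution_right L locallyIntegrable_inv hg1 z).fderiv,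
      convolution_precompR_apply L locallyIntegrable_inv (hc.fderiv ℝ)
      (hg1.continuous_fderiv one_ne_zero)]
    rfl
  have hwi : ∀ z y, Integrable (fun ζ : ℂ => ζ⁻¹ * fderiv ℝ g (z - ζ) y) := fun z y =>
    HasCompactSupport.convolutionExists_right L (hc.fderiv_apply ℝ y) locallyIntegrable_inv
      ((hg1.continuous_fderiv one_ne_zero).clm_apply continuous_const) z
  refine ⟨fun z => c * w z, contDiff_const.mul hw, fun z => ?_, ?_⟩
  · have hgz : ContDiff ℝ 1 (fun ζ => g (z - ζ)) := hg1.comp (contDiff_const.sub contDiff_id)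
    have hgc : HasCompactSupport (fun ζ => g (z - ζ)) := hc.comp_homeomorph (Homeomorph.subLeft z)
    have hgd : ∀ ζ y, fderiv ℝ (fun ζ => g (z - ζ)) ζ y = -fderiv ℝ g (z - ζ) y := fun ζ y => by
      have h1 : HasFDerivAt (fun ζ : ℂ => z - ζ) (-ContinuousLinearMap.id ℝ ℂ) ζ :=
        (hasFDerivAt_id ζ).const_sub z
      have h2 := ((hg1.differentiable one_ne_zero (z - ζ)).hasFDerivAt).comp ζ h1
      have h3 := h2.fderiv
      simp only [Function.comp_def] at h3
      rw [h3]; simp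
    have key := integral_inv_mul_dbar hgz hgc
    simp only [hgd, sub_zero] at key
    have hsplit : ∫ ζ : ℂ, ζ⁻¹ * (-fderiv ℝ g (z - ζ) 1 + I * -fderiv ℝ g (z - ζ) I) =
        -(fderiv ℝ w z 1 + I * fderiv ℝ w z I) := by
      rw [hwd, hwd, ← integral_const_mul, ← integral_add (hwi z 1) ((hwi z I).const_mul I),
        ← integral_neg]
      congr 1
      ext ζ
      ring
    rw [hsplit] at key
    have hdw : DifferentiableAt ℝ w z := hw.differentiable (by simp) z
    rw [fderiv_const_mul hdw]
    simp only [smul_apply, smul_eq_mul]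
    linear_combination (-c) * key + g z * hcπ
  · obtain ⟨R, hRpos, hR⟩ := hc.isCompact.isBounded.exists_pos_norm_lt
    have hzero : ∀ z, R ≤ ‖z‖ → g z = 0 := fun z hz =>
      image_eq_zero_of_notMem_tsupport fun hm => absurd (hR z hm) (not_lt.2 hz)
    have hgi : Integrable g := hg.continuous.integrable_of_hasCompactSupport hc
    have hb : ∀ z : ℂ, R < ‖z‖ → ‖c * w z‖ ≤ ‖c‖ * (∫ ζ, ‖g ζ‖) * (‖z‖ - R)⁻¹ := fun z hz => by
      have hpos : 0 < ‖z‖ - R := sub_pos.2 hz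
      rw [norm_mul, mul_assoc]
      refine mul_le_mul_of_nonneg_left ?_ (norm_nonneg _)
      have h1 : ‖w z‖ ≤ ∫ ζ, ‖g (z - ζ)‖ * (‖z‖ - R)⁻¹ := by
        refine norm_integral_le_of_norm_le
          (((integrable_comp_sub_left (f := g) z).2 hgi).norm.mul_const _)
          (Eventually.of_forall fun ζ => ?_)
        simp only [L, ContinuousLinearMap.mul_apply', norm_mul, norm_inv]
        by_cases hζ : R ≤ ‖z - ζ‖
        · simp [hzero _ hζ]
        · rw [mul_comm]
          refine mul_le_mul_of_nonneg_left ?_ (norm_nonneg _)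
          refine inv_anti₀ hpos ?_
          have := norm_sub_norm_le z ζ
          linarith [not_le.1 hζ]
      rwa [integral_mul_const, integral_sub_left_eq_self (fun ζ => ‖g ζ‖)] at h1
    refine squeeze_zero_norm' (a := fun z => ‖c‖ * (∫ ζ, ‖g ζ‖) * (‖z‖ - R)⁻¹) ?_ ?_
    · filter_upwards [(tendsto_norm_cocompact_atTop (E := ℂ)).eventually_gt_atTop R] with z hz
        using hb z hz
    · have h1 : Tendsto (fun z : ℂ => ‖z‖ - R) (cocompact ℂ) atTop :=
        tendsto_atTop_add_const_right _ _ (tendsto_norm_cocompact_atTop (E := ℂ))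
      simpa using (tendsto_inv_atTop_zero.comp h1).const_mul (‖c‖ * (∫ ζ, ‖g ζ‖))

end

/-! ### Stereographic projection and the Cauchy–Riemann equations on the sphere -/

/-- The inverse of the stereographic projection from the pole `(0, 0, σ)`, for `σ = ±1`. -/
def stereoInv (σ : ℝ) (z : ℂ) : E3 :=
  !₂[2 * z.re * (1 + z.re ^ 2 + z.im ^ 2)⁻¹, 2 * z.im * (1 + z.re ^ 2 + z.im ^ 2)⁻¹,
    σ * (1 - 2 * (1 + z.re ^ 2 + z.im ^ 2)⁻¹)]

lemma stereoInv_zero (σ : ℝ) (z : ℂ) :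
    stereoInv σ z 0 = 2 * z.re * (1 + z.re ^ 2 + z.im ^ 2)⁻¹ := rfl

lemma stereoInv_one (σ : ℝ) (z : ℂ) :
    stereoInv σ z 1 = 2 * z.im * (1 + z.re ^ 2 + z.im ^ 2)⁻¹ := rfl

lemma stereoInv_two (σ : ℝ) (z : ℂ) :
    stereoInv σ z 2 = σ * (1 - 2 * (1 + z.re ^ 2 + z.im ^ 2)⁻¹) := rfl

lemma stereoDenom_pos (z : ℂ) : 0 < 1 + z.re ^ 2 + z.im ^ 2 := by positivity

lemma stereoInv_mem {σ : ℝ} (hσ : σ * σ = 1) (z : ℂ) : stereoInv σ z ∈ Metric.sphere (0 : E3) 1 := by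
  have h := (stereoDenom_pos z).ne'
  rw [mem_sphere_zero_iff_norm, EuclideanSpace.norm_eq, Real.sqrt_eq_one, Fin.sum_univ_three]
  simp only [Real.norm_eq_abs, sq_abs, stereoInv_zero, stereoInv_one, stereoInv_two]
  field_simp
  linear_combination ((1 + z.re ^ 2 + z.im ^ 2) - 2) ^ 2 * hσ

lemma contDiff_stereoInv (σ : ℝ) : ContDiff ℝ ∞ (stereoInv σ) := by
  have hre : ContDiff ℝ ∞ (fun z : ℂ => z.re) := Complex.reCLM.contDiff
  have him : ContDiff ℝ ∞ (fun z : ℂ => z.im) := Complex.imCLM.contDiff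
  have hn : ContDiff ℝ ∞ (fun z : ℂ => (1 + z.re ^ 2 + z.im ^ 2)⁻¹) :=
    ((contDiff_const.add (hre.pow 2)).add (him.pow 2)).inv fun z => (stereoDenom_pos z).ne'
  rw [contDiff_euclidean]
  intro i
  fin_cases i
  · exact (contDiff_const.mul hre).mul hn
  · exact (contDiff_const.mul him).mul hn
  · exact contDiff_const.mul (contDiff_const.sub (contDiff_const.mul hn))

lemma hasFDerivAt_stereoDenom (z : ℂ) :
    HasFDerivAt (fun z : ℂ => (1 + z.re ^ 2 + z.im ^ 2)⁻¹)
      (-((1 + z.re ^ 2 + z.im ^ 2) ^ 2)⁻¹ •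
        ((2 * z.re) • Complex.reCLM + (2 * z.im) • Complex.imCLM)) z := by
  have hre : HasFDerivAt (fun z : ℂ => z.re) Complex.reCLM z := Complex.reCLM.hasFDerivAt
  have him : HasFDerivAt (fun z : ℂ => z.im) Complex.imCLM z := Complex.imCLM.hasFDerivAt
  have h := (hasDerivAt_inv (stereoDenom_pos z).ne').comp_hasFDerivAt z
    (((hre.pow 2).const_add 1).add (him.pow 2))
  refine h.congr_fderiv ?_
  ext y; simp

/-- The two coordinate vector fields of the stereographic chart in terms of the point
`x = stereoInv σ z` itself; the components along `x` are irrelevant for tangential derivatives. -/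
lemma fderiv_stereoInv {σ : ℝ} (hσ : σ * σ = 1) (z y : ℂ) :
    fderiv ℝ (stereoInv σ) z y =
      ((1 - σ * stereoInv σ z 2) * y.re) • e 0 + ((1 - σ * stereoInv σ z 2) * y.im) • e 1 +
      (σ * (stereoInv σ z 0 * y.re + stereoInv σ z 1 * y.im)) • e 2 -
      (stereoInv σ z 0 * y.re + stereoInv σ z 1 * y.im) • stereoInv σ z := by
  have hre : HasFDerivAt (fun z : ℂ => z.re) Complex.reCLM z := Complex.reCLM.hasFDerivAt
  have him : HasFDerivAt (fun z : ℂ => z.im) Complex.imCLM z := Complex.imCLM.hasFDerivAt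
  have hn := hasFDerivAt_stereoDenom z
  have hd : DifferentiableAt ℝ (stereoInv σ) z :=
    (contDiff_stereoInv σ).differentiable (by simp) z
  have hcomp : ∀ i, (fderiv ℝ (stereoInv σ) z y) i = fderiv ℝ (fun z => stereoInv σ z i) z y :=
    fun i => by
      have := ((EuclideanSpace.proj i : E3 →L[ℝ] ℝ).hasFDerivAt.comp z hd.hasFDerivAt).fderiv
      exact (DFunLike.congr_fun this y).symm
  have h := (stereoDenom_pos z).ne'
  have h0 := ((hre.const_mul 2).fun_mul hn).fderiv
  have h1 := ((him.const_mul 2).fun_mul hn).fderiv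
  have h2 := (((hn.const_mul 2).const_sub 1).const_mul σ).fderiv
  ext i
  rw [hcomp]
  fin_cases i
  · simp only [Fin.zero_eta, stereoInv_zero, h0]
    simp [e, stereoInv_zero, stereoInv_one, stereoInv_two]
    field_simp
    linear_combination (y.re * ((z.re ^ 2 + z.im ^ 2 + 1) - 2) * (z.re ^ 2 + z.im ^ 2 + 1)) * hσ
  · simp only [Fin.mk_one, stereoInv_one, h1]
    simp [e, stereoInv_zero, stereoInv_one, stereoInv_two]
    field_simp
    linear_combination (y.im * ((z.re ^ 2 + z.im ^ 2 + 1) - 2) * (z.re ^ 2 + z.im ^ 2 + 1)) * hσ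
  · simp only [Fin.reduceFinMk, stereoInv_two, h2]
    simp [e, stereoInv_zero, stereoInv_one, stereoInv_two]
    field_simp
    ring

/-- Complex stereographic coordinate of a point other than the pole `(0, 0, σ)`. -/
def stereo (σ : ℝ) (y : E3) : ℂ := (1 - σ * y 2 : ℝ)⁻¹ • (y 0 + y 1 * Complex.I : ℂ)

/-- The inverse of the complex stereographic coordinate, a complex coordinate around the pole
`(0, 0, σ)`. -/
def stereoPole (σ : ℝ) (y : E3) : ℂ := (1 + σ * y 2 : ℝ)⁻¹ • (y 0 - y 1 * Complex.I : ℂ)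

lemma stereo_re (σ : ℝ) (y : E3) : (stereo σ y).re = (1 - σ * y 2)⁻¹ * y 0 := by
  rw [stereo, Complex.smul_re]; simp

lemma stereo_im (σ : ℝ) (y : E3) : (stereo σ y).im = (1 - σ * y 2)⁻¹ * y 1 := by
  rw [stereo, Complex.smul_im]; simp

lemma stereoPole_re (σ : ℝ) (y : E3) : (stereoPole σ y).re = (1 + σ * y 2)⁻¹ * y 0 := by
  rw [stereoPole, Complex.smul_re]; simp

lemma stereoPole_im (σ : ℝ) (y : E3) : (stereoPole σ y).im = -((1 + σ * y 2)⁻¹ * y 1) := by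
  rw [stereoPole, Complex.smul_im]; simp

lemma contDiffAt_coordinate (i : Fin 3) (y : E3) : ContDiffAt ℝ ∞ (fun y : E3 => y i) y :=
  (EuclideanSpace.proj i : E3 →L[ℝ] ℝ).contDiff.contDiffAt

lemma contDiffAt_stereo {σ : ℝ} {y : E3} (hy : σ * y 2 ≠ 1) : ContDiffAt ℝ ∞ (stereo σ) y := by
  have hc := fun i => contDiffAt_coordinate i y
  have h0 := fun i => Complex.ofRealCLM.contDiff.contDiffAt.comp y (hc i) (n := ∞)
  exact ((contDiffAt_const.sub (contDiffAt_const.mul (hc 2))).inv (sub_ne_zero.2 hy.symm)).smul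
    ((h0 0).add ((h0 1).mul contDiffAt_const))

lemma contDiffAt_stereoPole {σ : ℝ} {y : E3} (hy : 1 + σ * y 2 ≠ 0) :
    ContDiffAt ℝ ∞ (stereoPole σ) y := by
  have hc := fun i => contDiffAt_coordinate i y
  have h0 := fun i => Complex.ofRealCLM.contDiff.contDiffAt.comp y (hc i) (n := ∞)
  exact ((contDiffAt_const.add (contDiffAt_const.mul (hc 2))).inv hy).smul
    ((h0 0).sub ((h0 1).mul contDiffAt_const))

lemma sq_add_sq_add_sq (x : S2) : (x : E3) 0 ^ 2 + (x : E3) 1 ^ 2 + (x : E3) 2 ^ 2 = 1 := by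
  have h := DFunLike.congr_fun sum_coord_sq x
  simpa [pow_two] using h

lemma stereo_stereoInv {σ : ℝ} (hσ : σ * σ = 1) (z : ℂ) : stereo σ (stereoInv σ z) = z := by
  have h := (stereoDenom_pos z).ne'
  have h1 : 1 - σ * stereoInv σ z 2 = 2 * (1 + z.re ^ 2 + z.im ^ 2)⁻¹ := by
    rw [stereoInv_two]; linear_combination (2 * (1 + z.re ^ 2 + z.im ^ 2)⁻¹ - 1) * hσ
  apply Complex.ext
  · rw [stereo_re, h1, stereoInv_zero]; field_simp
  · rw [stereo_im, h1, stereoInv_one]; field_simp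

lemma stereoInv_ne_pole {σ : ℝ} (hσ : σ * σ = 1) (z : ℂ) : σ * stereoInv σ z 2 ≠ 1 := by
  have h := stereoDenom_pos z
  have h1 : 1 - σ * stereoInv σ z 2 = 2 * (1 + z.re ^ 2 + z.im ^ 2)⁻¹ := by
    rw [stereoInv_two]; linear_combination (2 * (1 + z.re ^ 2 + z.im ^ 2)⁻¹ - 1) * hσ
  have h2 : 0 < 2 * (1 + z.re ^ 2 + z.im ^ 2)⁻¹ := by positivity
  intro h3
  linarith

lemma stereoInv_stereo {σ : ℝ} (hσ : σ * σ = 1) {x : S2} (hx : σ * (x : E3) 2 ≠ 1) :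
    stereoInv σ (stereo σ x) = x := by
  have hs := sq_add_sq_add_sq x
  have hl : 1 - σ * (x : E3) 2 ≠ 0 := sub_ne_zero.2 hx.symm
  have hre : (stereo σ x).re = (1 - σ * (x : E3) 2)⁻¹ * (x : E3) 0 := stereo_re σ x
  have him : (stereo σ x).im = (1 - σ * (x : E3) 2)⁻¹ * (x : E3) 1 := stereo_im σ x
  have hn : (1 + (stereo σ x).re ^ 2 + (stereo σ x).im ^ 2)⁻¹ = (1 - σ * (x : E3) 2) / 2 := by
    rw [inv_eq_iff_eq_inv, hre, him]
    field_simp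
    linear_combination hs + (x : E3) 2 ^ 2 * hσ
  ext i
  fin_cases i
  · rw [Fin.zero_eta, stereoInv_zero, hn, hre]; field_simp
  · rw [Fin.mk_one, stereoInv_one, hn, him]; field_simp
  · simp only [Fin.reduceFinMk, stereoInv_two, hn]; linear_combination (x : E3) 2 * hσ

lemma inv_stereoPole {σ : ℝ} (hσ : σ * σ = 1) {x : S2} (hx : σ * (x : E3) 2 ≠ 1)
    (hx' : 1 + σ * (x : E3) 2 ≠ 0) : (stereoPole σ x)⁻¹ = stereo σ x := by
  have hs := sq_add_sq_add_sq x
  have hl : 1 - σ * (x : E3) 2 ≠ 0 := sub_ne_zero.2 hx.symm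
  refine inv_eq_of_mul_eq_one_right ?_
  have h : (1 - σ * (x : E3) 2) * (1 + σ * (x : E3) 2) = (x : E3) 0 ^ 2 + (x : E3) 1 ^ 2 := by
    linear_combination -hs - (x : E3) 2 ^ 2 * hσ
  rw [stereo, stereoPole, smul_mul_smul_comm]
  have h2 : ((x : E3) 0 - (x : E3) 1 * Complex.I : ℂ) * ((x : E3) 0 + (x : E3) 1 * Complex.I) =
      (((1 - σ * (x : E3) 2) * (1 + σ * (x : E3) 2) : ℝ) : ℂ) := by
    rw [h]; push_cast; linear_combination (-(x : E3) 1 ^ 2 : ℂ) * Complex.I_sq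
  rw [h2, Complex.real_smul, ← Complex.ofReal_mul]
  norm_cast
  field_simp

lemma coordinates_eq_zero {σ : ℝ} (hσ : σ * σ = 1) {x : S2} (hx : σ * (x : E3) 2 = 1) :
    (x : E3) 0 = 0 ∧ (x : E3) 1 = 0 := by
  have hs := sq_add_sq_add_sq x
  have h2 : (x : E3) 2 ^ 2 = 1 := by
    linear_combination (σ * (x : E3) 2 + 1) * hx - (x : E3) 2 ^ 2 * hσ
  constructor <;> nlinarith [sq_nonneg ((x : E3) 0), sq_nonneg ((x : E3) 1)]

/-- Near infinity the solution `v` of `exists_dbar` is a holomorphic function of `z⁻¹`. -/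
lemma analyticAt_comp_inv {v g : ℂ → ℂ} (hv : ContDiff ℝ ∞ v)
    (hcr : ∀ z, fderiv ℝ v z 1 + Complex.I * fderiv ℝ v z Complex.I = g z)
    (hlim : Tendsto v (cocompact ℂ) (𝓝 0)) (hg : HasCompactSupport g) :
    AnalyticAt ℂ (Function.update (fun w => v w⁻¹) 0 0) 0 := by
  have hinv : Tendsto (fun w : ℂ => w⁻¹) (𝓝[≠] 0) (cocompact ℂ) := by
    rw [← Metric.cobounded_eq_cocompact]; exact tendsto_inv₀_nhdsNE_zero
  refine Complex.analyticAt_of_differentiable_on_punctured_nhds_of_continuousAt ?_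
    (continuousAt_update_same.2 (hlim.comp hinv))
  have hev : ∀ᶠ w : ℂ in 𝓝[≠] 0, w⁻¹ ∈ (tsupport g)ᶜ := hinv hg.isCompact.compl_mem_cocompact
  filter_upwards [hev, self_mem_nhdsWithin] with w hw hw0
  have hw0 : w ≠ 0 := hw0
  have h1 : g w⁻¹ = 0 := image_eq_zero_of_notMem_tsupport hw
  have h2 : DifferentiableAt ℂ v w⁻¹ := by
    refine differentiableAt_complex_iff_differentiableAt_real.2
      ⟨hv.differentiable (by simp) _, ?_⟩
    have h3 := hcr w⁻¹
    rw [h1] at h3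
    rw [smul_eq_mul]
    linear_combination (-Complex.I) * h3 + fderiv ℝ v w⁻¹ Complex.I * Complex.I_sq
  have h4 : DifferentiableAt ℂ (fun w => v w⁻¹) w := h2.comp w (differentiableAt_inv hw0)
  refine h4.congr_of_eventuallyEq ?_
  filter_upwards [isOpen_ne.mem_nhds hw0] with y hy
  exact Function.update_of_ne hy _ _

/-- The inhomogeneous Cauchy–Riemann equations on the sphere for the stereographic projection from
the pole `(0, 0, σ)`, with a right-hand side vanishing near that pole. In the stereographic
coordinate `z` the equations say `(∂_x + i ∂_y) (u₁ + i u₂) = t₁ + i t₂`; the solution by the Cauchy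
transform extends to the pole as a holomorphic function of `z⁻¹`. -/
theorem exists_cauchyRiemann {σ : ℝ} (hσ : σ * σ = 1) (t₁ t₂ : SmoothFun)
    (h₁ : ∀ x : S2, 1 / 2 ≤ σ * (x : E3) 2 → t₁ x = 0)
    (h₂ : ∀ x : S2, 1 / 2 ≤ σ * (x : E3) 2 → t₂ x = 0) :
    ∃ u₁ u₂ : SmoothFun, ∀ x : S2,
      ((1 - σ * (x : E3) 2) * tanDeriv 0 u₁ x + σ * (x : E3) 0 * tanDeriv 2 u₁ x) -
        ((1 - σ * (x : E3) 2) * tanDeriv 1 u₂ x + σ * (x : E3) 1 * tanDeriv 2 u₂ x) = t₁ x ∧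
      ((1 - σ * (x : E3) 2) * tanDeriv 0 u₂ x + σ * (x : E3) 0 * tanDeriv 2 u₂ x) +
        ((1 - σ * (x : E3) 2) * tanDeriv 1 u₁ x + σ * (x : E3) 1 * tanDeriv 2 u₁ x) = t₂ x := by
  let φ : ℂ → S2 := fun z => ⟨stereoInv σ z, stereoInv_mem hσ z⟩
  have hφ2 : ∀ z, σ * stereoInv σ z 2 ≠ 1 := stereoInv_ne_pole hσ
  have hcomp : ∀ u : SmoothFun, ContDiff ℝ ∞ (fun z => u (φ z)) := fun u => by
    have h : (fun z => u (φ z)) = radialExt u ∘ stereoInv σ :=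
      funext fun z => (radialExt_coe u (φ z)).symm
    rw [h, contDiff_iff_contDiffAt]
    exact fun z => (u.isSmooth.contDiffAt_radialExt (ne_zero (φ z))).comp z
      (contDiff_stereoInv σ).contDiffAt
  let g : ℂ → ℂ := fun z => t₁ (φ z) + t₂ (φ z) * Complex.I
  have hg : ContDiff ℝ ∞ g :=
    (Complex.ofRealCLM.contDiff.comp (hcomp t₁)).add
      ((Complex.ofRealCLM.contDiff.comp (hcomp t₂)).mul contDiff_const)
  have hgc : HasCompactSupport g := by
    refine HasCompactSupport.intro (isCompact_closedBall 0 2) fun z hz => ?_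
    have hz2 : 4 < z.re ^ 2 + z.im ^ 2 := by
      have h4 : 2 < ‖z‖ := by simpa using hz
      have h5 := Complex.sq_norm z
      rw [Complex.normSq_apply] at h5
      nlinarith
    have h3 : 1 / 2 ≤ σ * (φ z : E3) 2 := by
      have h6 : σ * (φ z : E3) 2 = 1 - 2 * (1 + z.re ^ 2 + z.im ^ 2)⁻¹ := by
        change σ * stereoInv σ z 2 = _
        rw [stereoInv_two]; linear_combination (1 - 2 * (1 + z.re ^ 2 + z.im ^ 2)⁻¹) * hσ
      have h7 : (1 + z.re ^ 2 + z.im ^ 2)⁻¹ ≤ 4⁻¹ := inv_anti₀ (by norm_num) (by linarith)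
      rw [h6]; linarith
    simp [g, h₁ _ h3, h₂ _ h3]
  obtain ⟨v, hv, hcr, hlim⟩ := exists_dbar hg hgc
  have hH := analyticAt_comp_inv hv hcr hlim hgc
  set H : ℂ → ℂ := Function.update (fun w => v w⁻¹) 0 0 with hHdef
  let u : S2 → ℂ := fun x => if σ * (x : E3) 2 = 1 then 0 else v (stereo σ x)
  have hcont : Continuous (fun x : S2 => σ * (x : E3) 2) :=
    continuous_const.mul ((coord 2).contMDiff.continuous)
  have hu : IsSmooth u := by
    refine isSmooth_of_locally fun x => ?_
    by_cases hx : σ * (x : E3) 2 = 1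
    · obtain ⟨hx0, hx1⟩ := coordinates_eq_zero hσ hx
      have hW : stereoPole σ x = 0 := by simp [stereoPole, hx0, hx1]
      refine ⟨fun y => H (stereoPole σ y), ?_, ?_⟩
      · have hHa : ContDiffAt ℝ ∞ H (stereoPole σ x) := by
          rw [hW]; exact (hH.contDiffAt (n := ∞)).restrict_scalars ℝ
        exact hHa.comp _ (contDiffAt_stereoPole (by rw [hx]; norm_num))
      · have hopen : ∀ᶠ y : S2 in 𝓝 x, 0 < σ * (y : E3) 2 :=
          hcont.continuousAt.eventually (lt_mem_nhds (by simp [hx]))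
        filter_upwards [hopen] with y hy
        have hy' : 1 + σ * (y : E3) 2 ≠ 0 := by positivity
        by_cases hy1 : σ * (y : E3) 2 = 1
        · obtain ⟨hy0, hy1'⟩ := coordinates_eq_zero hσ hy1
          simp [u, hy1, H, stereoPole, hy0, hy1']
        · have hne : stereoPole σ y ≠ 0 := fun h0 => by
            have h8 := congrArg Complex.re h0
            have h9 := congrArg Complex.im h0
            rw [stereoPole_re] at h8
            rw [stereoPole_im] at h9
            simp [hy'] at h8 h9
            have hs := sq_add_sq_add_sq y
            rw [h8, h9] at hs
            have : (σ * (y : E3) 2 - 1) * (1 + σ * (y : E3) 2) = 0 := by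
              linear_combination (y : E3) 2 ^ 2 * hσ + hs
            exact hy1 (sub_eq_zero.1 ((mul_eq_zero.1 this).resolve_right hy'))
          simp only [u, hy1, if_false, H]
          rw [Function.update_of_ne hne, inv_stereoPole hσ hy1 hy']
    · refine ⟨fun y => v (stereo σ y), hv.contDiffAt.comp _ (contDiffAt_stereo hx), ?_⟩
      filter_upwards [hcont.continuousAt.eventually_ne hx] with y hy
      simp [u, hy]
  have huφ : ∀ z, u (φ z) = v z := fun z => by
    have : (φ z : E3) = stereoInv σ z := rfl
    simp only [u, this, hφ2, if_false, stereo_stereoInv hσ]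
  let u₁ : SmoothFun := ⟨fun x => (u x).re, Complex.reCLM.contDiff.contMDiff.comp hu⟩
  let u₂ : SmoothFun := ⟨fun x => (u x).im, Complex.imCLM.contDiff.contMDiff.comp hu⟩
  have hchain : ∀ (w : SmoothFun) (z y : ℂ), fderiv ℝ (fun z => w (φ z)) z y =
      (1 - σ * stereoInv σ z 2) * y.re * tanDeriv 0 w (φ z) +
      (1 - σ * stereoInv σ z 2) * y.im * tanDeriv 1 w (φ z) +
      σ * (stereoInv σ z 0 * y.re + stereoInv σ z 1 * y.im) * tanDeriv 2 w (φ z) := fun w z y => by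
    have h : (fun z => w (φ z)) = radialExt w ∘ stereoInv σ :=
      funext fun z => (radialExt_coe w (φ z)).symm
    have hs : fderiv ℝ (radialExt w) (stereoInv σ z) (stereoInv σ z) = 0 :=
      tderiv_self w.isSmooth (φ z)
    rw [h, fderiv_comp z (w.isSmooth.differentiableAt_radialExt (ne_zero (φ z)))
      ((contDiff_stereoInv σ).differentiable (by simp) z), ContinuousLinearMap.comp_apply,
      fderiv_stereoInv hσ]
    simp only [map_sub, map_add, map_smul, hs, smul_eq_mul, mul_zero, sub_zero]
    rfl
  refine ⟨u₁, u₂, fun x => ?_⟩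
  by_cases hx : σ * (x : E3) 2 = 1
  · obtain ⟨hx0, hx1⟩ := coordinates_eq_zero hσ hx
    have hge : 1 / 2 ≤ σ * (x : E3) 2 := by rw [hx]; norm_num
    rw [h₁ x hge, h₂ x hge, hx, hx0, hx1]
    simp
  · set z := stereo σ x with hz
    have hφz : φ z = x := Subtype.ext (stereoInv_stereo hσ hx)
    have hφz' : stereoInv σ z = (x : E3) := stereoInv_stereo hσ hx
    have hvz := (hv.differentiable (by simp) z).hasFDerivAt
    have hre : ∀ y, fderiv ℝ (fun z => u₁ (φ z)) z y = (fderiv ℝ v z y).re := fun y => by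
      have h : (fun z => u₁ (φ z)) = Complex.reCLM ∘ v := funext fun z => by
        change (u (φ z)).re = _; rw [huφ]; rfl
      rw [h, (Complex.reCLM.hasFDerivAt.comp z hvz).fderiv]; rfl
    have him : ∀ y, fderiv ℝ (fun z => u₂ (φ z)) z y = (fderiv ℝ v z y).im := fun y => by
      have h : (fun z => u₂ (φ z)) = Complex.imCLM ∘ v := funext fun z => by
        change (u (φ z)).im = _; rw [huφ]; rfl
      rw [h, (Complex.imCLM.hasFDerivAt.comp z hvz).fderiv]; rfl
    have key := hcr z
    have kre := congrArg Complex.re key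
    have kim := congrArg Complex.im key
    simp only [g, hφz, Complex.add_re, Complex.add_im, Complex.mul_re, Complex.mul_im,
      Complex.I_re, Complex.I_im, Complex.ofReal_re, Complex.ofReal_im, ← hre, ← him, hchain,
      hφz', Complex.one_re, Complex.one_im] at kre kim
    constructor <;> linarith

/-! ### Tensor calculus in components -/

/-- The components `δ_ij - x_i x_j` of the round metric. -/
def metricComp (i j : Fin 3) : SmoothFun := (if i = j then 1 else 0) - coord i * coord j

lemma metricComp_comm (i j : Fin 3) : metricComp i j = metricComp j i := by
  simp only [metricComp, eq_comm, mul_comm]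

lemma tanDeriv_coord' (i j : Fin 3) : tanDeriv i (coord j) = metricComp i j := tanDeriv_coord i j

/-- A vector of smooth functions is tangential if it is pointwise orthogonal to the position. -/
def IsTangential (p : Fin 3 → SmoothFun) : Prop :=
  coord 0 * p 0 + coord 1 * p 1 + coord 2 * p 2 = 0

/-- The components of the gradient. -/
def grad (u : SmoothFun) (i : Fin 3) : SmoothFun := tanDeriv i u

lemma isTangential_grad (u : SmoothFun) : IsTangential (grad u) := sum_coord_mul_tanDeriv u

/-- The divergence of a tangential one-form with components `p`. -/
def dvg (p : Fin 3 → SmoothFun) : SmoothFun := tanDeriv 0 (p 0) + tanDeriv 1 (p 1) + tanDeriv 2 (p 2)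

/-- The curl `x · (δ × p)` of a tangential one-form with components `p`. -/
def crl (p : Fin 3 → SmoothFun) : SmoothFun :=
  coord 0 * (tanDeriv 1 (p 2) - tanDeriv 2 (p 1)) + coord 1 * (tanDeriv 2 (p 0) - tanDeriv 0 (p 2)) +
    coord 2 * (tanDeriv 0 (p 1) - tanDeriv 1 (p 0))

/-- The components `x × p` of the Hodge dual of the one-form with components `p`. -/
def cross (p : Fin 3 → SmoothFun) : Fin 3 → SmoothFun :=
  ![coord 1 * p 2 - coord 2 * p 1, coord 2 * p 0 - coord 0 * p 2, coord 0 * p 1 - coord 1 * p 0]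

@[simp] lemma cross_zero (p : Fin 3 → SmoothFun) : cross p 0 = coord 1 * p 2 - coord 2 * p 1 := rfl
@[simp] lemma cross_one (p : Fin 3 → SmoothFun) : cross p 1 = coord 2 * p 0 - coord 0 * p 2 := rfl
@[simp] lemma cross_two (p : Fin 3 → SmoothFun) : cross p 2 = coord 0 * p 1 - coord 1 * p 0 := rfl

lemma isTangential_cross (p : Fin 3 → SmoothFun) : IsTangential (cross p) := by
  simp only [IsTangential, cross_zero, cross_one, cross_two]; ring

/-- The covariant derivative `∇_i p_j` of a tangential one-form: the term `x_j p_i` is the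
tangential projection of `δ_i p_j` in the index `j`. -/
def covDeriv (p : Fin 3 → SmoothFun) (i j : Fin 3) : SmoothFun := tanDeriv i (p j) + coord j * p i

/-- Twice the trace-free symmetrized covariant derivative (the conformal Killing operator). -/
def killing (p : Fin 3 → SmoothFun) (i j : Fin 3) : SmoothFun :=
  covDeriv p j i + covDeriv p i j - dvg p * metricComp i j

/-- The divergence of a symmetric traceless tangential two-tensor with components `S`. The correction
terms of the tangential projection are multiples of the trace and of the normal components of `S`. -/
def dvgTwo (S : Fin 3 → Fin 3 → SmoothFun) (j : Fin 3) : SmoothFun :=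
  tanDeriv 0 (S 0 j) + tanDeriv 1 (S 1 j) + tanDeriv 2 (S 2 j)

lemma dvg_add (p q : Fin 3 → SmoothFun) : dvg (p + q) = dvg p + dvg q := by
  simp only [dvg, Pi.add_apply, map_add]; ring

lemma crl_add (p q : Fin 3 → SmoothFun) : crl (p + q) = crl p + crl q := by
  simp only [crl, Pi.add_apply, map_add]; ring

lemma crl_sub (p q : Fin 3 → SmoothFun) : crl (p - q) = crl p - crl q := by
  simp only [crl, Pi.sub_apply, map_sub]; ring

lemma killing_add (p q : Fin 3 → SmoothFun) (i j : Fin 3) :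
    killing (p + q) i j = killing p i j + killing q i j := by
  simp only [killing, covDeriv, dvg_add, Pi.add_apply, map_add]; ring

lemma killing_sub (p q : Fin 3 → SmoothFun) (i j : Fin 3) :
    killing (p - q) i j = killing p i j - killing q i j := by
  simp only [killing, covDeriv, dvg, Pi.sub_apply, map_sub]; ring

lemma IsTangential.add {p q : Fin 3 → SmoothFun} (hp : IsTangential p) (hq : IsTangential q) :
    IsTangential (p + q) := by
  simp only [IsTangential, Pi.add_apply] at *; linear_combination hp + hq

lemma IsTangential.sub {p q : Fin 3 → SmoothFun} (hp : IsTangential p) (hq : IsTangential q) :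
    IsTangential (p - q) := by
  simp only [IsTangential, Pi.sub_apply] at *; linear_combination hp - hq

lemma IsTangential.smul {p : Fin 3 → SmoothFun} (hp : IsTangential p) (u : SmoothFun) :
    IsTangential (u • p) := by
  simp only [IsTangential, Pi.smul_apply, smul_eq_mul] at *; linear_combination u * hp

/-- Differentiating `x · p = 0`. -/
lemma IsTangential.sum_coord_mul_tanDeriv {p : Fin 3 → SmoothFun} (hp : IsTangential p)
    (j : Fin 3) :
    coord 0 * tanDeriv j (p 0) + coord 1 * tanDeriv j (p 1) + coord 2 * tanDeriv j (p 2) = -p j := by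
  have hp' : coord 0 * p 0 + coord 1 * p 1 + coord 2 * p 2 = 0 := hp
  have h := congrArg (tanDeriv j) hp'
  simp only [map_add, Derivation.leibniz, smul_eq_mul, tanDeriv_coord, map_zero] at h
  fin_cases j <;> simp at h ⊢
  · linear_combination h + coord 0 * hp'
  · linear_combination h + coord 1 * hp'
  · linear_combination h + coord 2 * hp'

lemma dvg_grad (u : SmoothFun) : dvg (grad u) = lap u := rfl

lemma crl_grad (u : SmoothFun) : crl (grad u) = 0 := by
  have h01 := tanDeriv_comm 0 1 u
  have h12 := tanDeriv_comm 1 2 u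
  have h20 := tanDeriv_comm 2 0 u
  simp only [crl, grad]
  linear_combination coord 0 * h12 + coord 1 * h20 + coord 2 * h01

lemma dvg_cross (q : Fin 3 → SmoothFun) : dvg (cross q) = -crl q := by
  simp only [dvg, crl, cross_zero, cross_one, cross_two, map_sub, Derivation.leibniz, smul_eq_mul,
    tanDeriv_coord]
  simp
  ring

lemma crl_cross {q : Fin 3 → SmoothFun} (hq : IsTangential q) : crl (cross q) = dvg q := by
  have h0 := hq.sum_coord_mul_tanDeriv 0
  have h1 := hq.sum_coord_mul_tanDeriv 1
  have h2 := hq.sum_coord_mul_tanDeriv 2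
  have hx := sum_coord_sq
  have hq' : coord 0 * q 0 + coord 1 * q 1 + coord 2 * q 2 = 0 := hq
  simp only [dvg, crl, cross_zero, cross_one, cross_two, map_sub, Derivation.leibniz, smul_eq_mul,
    tanDeriv_coord]
  simp
  linear_combination (tanDeriv 0 (q 0) + tanDeriv 1 (q 1) + tanDeriv 2 (q 2)) * hx
    - coord 0 * h0 - coord 1 * h1 - coord 2 * h2 - hq'

/-- A tangential one-form with vanishing curl is closed. -/
lemma covDeriv_comm_of_crl_eq_zero {p : Fin 3 → SmoothFun} (hp : IsTangential p) (h : crl p = 0)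
    (i j : Fin 3) : covDeriv p i j = covDeriv p j i := by
  have h0 := hp.sum_coord_mul_tanDeriv 0
  have h1 := hp.sum_coord_mul_tanDeriv 1
  have h2 := hp.sum_coord_mul_tanDeriv 2
  have hx := sum_coord_sq
  have hp' : coord 0 * p 0 + coord 1 * p 1 + coord 2 * p 2 = 0 := hp
  have k0 := SphereTensor.sum_coord_mul_tanDeriv (p 0)
  have k1 := SphereTensor.sum_coord_mul_tanDeriv (p 1)
  have k2 := SphereTensor.sum_coord_mul_tanDeriv (p 2)
  simp only [crl] at h
  -- the antisymmetric part of `∇p` annihilates the position vector, so it is a multiple of the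
  -- area form
  have r0 : coord 1 * (covDeriv p 0 1 - covDeriv p 1 0) =
      coord 2 * (covDeriv p 2 0 - covDeriv p 0 2) := by
    simp only [covDeriv]
    linear_combination h0 - k0 + p 0 * hx - coord 0 * hp'
  have r1 : coord 2 * (covDeriv p 1 2 - covDeriv p 2 1) =
      coord 0 * (covDeriv p 0 1 - covDeriv p 1 0) := by
    simp only [covDeriv]
    linear_combination h1 - k1 + p 1 * hx - coord 1 * hp'
  have r2 : coord 0 * (covDeriv p 2 0 - covDeriv p 0 2) =
      coord 1 * (covDeriv p 1 2 - covDeriv p 2 1) := by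
    simp only [covDeriv]
    linear_combination h2 - k2 + p 2 * hx - coord 2 * hp'
  have h' : coord 0 * (covDeriv p 1 2 - covDeriv p 2 1) + coord 1 * (covDeriv p 2 0 - covDeriv p 0 2)
      + coord 2 * (covDeriv p 0 1 - covDeriv p 1 0) = 0 := by
    simp only [covDeriv]
    linear_combination h
  have e01 : covDeriv p 0 1 - covDeriv p 1 0 = 0 := by
    linear_combination coord 2 * h' - (covDeriv p 0 1 - covDeriv p 1 0) * hx
      + coord 1 * r0 - coord 0 * r1
  have e12 : covDeriv p 1 2 - covDeriv p 2 1 = 0 := by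
    linear_combination coord 0 * h' - (covDeriv p 1 2 - covDeriv p 2 1) * hx
      + coord 2 * r1 - coord 1 * r2
  have e20 : covDeriv p 2 0 - covDeriv p 0 2 = 0 := by
    linear_combination coord 1 * h' - (covDeriv p 2 0 - covDeriv p 0 2) * hx
      + coord 0 * r2 - coord 2 * r0
  fin_cases i <;> fin_cases j <;> simp
  · linear_combination e01
  · linear_combination -e20
  · linear_combination -e01
  · linear_combination e12
  · linear_combination e20
  · linear_combination -e12

lemma crl_eq_zero_of_covDeriv_comm {p : Fin 3 → SmoothFun}
    (h : ∀ i j, covDeriv p i j = covDeriv p j i) : crl p = 0 := by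
  have h01 := h 0 1
  have h12 := h 1 2
  have h20 := h 2 0
  simp only [covDeriv] at h01 h12 h20
  simp only [crl]
  linear_combination coord 0 * h12 + coord 1 * h20 + coord 2 * h01

@[simp] lemma tanDeriv_two (i : Fin 3) : tanDeriv i (2 : SmoothFun) = 0 := by
  simpa using (tanDeriv i).map_natCast 2

/-- The divergence of the conformal Killing operator. -/
lemma two_mul_dvgTwo {S : Fin 3 → Fin 3 → SmoothFun} {p : Fin 3 → SmoothFun} (hp : IsTangential p)
    (hS : ∀ i j, 2 * S i j = killing p i j) (j : Fin 3) :
    2 * dvgTwo S j = lap (p j) + 2 * p j + 2 * (coord j * dvg p) := by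
  have h := fun i => congrArg (tanDeriv i) (hS i j)
  simp only [killing, covDeriv, map_add, map_sub, Derivation.leibniz, smul_eq_mul, tanDeriv_two,
    metricComp, tanDeriv_coord] at h
  have h0 := h 0
  have h1 := h 1
  have h2 := h 2
  have c0 := tanDeriv_comm 0 j (p 0)
  have c1 := tanDeriv_comm 1 j (p 1)
  have c2 := tanDeriv_comm 2 j (p 2)
  have hp' : coord 0 * p 0 + coord 1 * p 1 + coord 2 * p 2 = 0 := hp
  have hj := hp.sum_coord_mul_tanDeriv j
  have hx := sum_coord_sq
  have hd := SphereTensor.sum_coord_mul_tanDeriv (dvg p)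
  have hpj := SphereTensor.sum_coord_mul_tanDeriv (p j)
  have hD : tanDeriv j (dvg p) = tanDeriv j (tanDeriv 0 (p 0)) + tanDeriv j (tanDeriv 1 (p 1)) +
    tanDeriv j (tanDeriv 2 (p 2)) := by simp [dvg]
  simp only [dvgTwo, lap]
  fin_cases j <;> simp at h0 h1 h2 c0 c1 c2 hj hpj hD ⊢
  · linear_combination h0 + h1 + h2 + c1 + c2 + hj + hpj - p 0 * hx - coord 0 * hp'
      + coord 0 * hd - 2 * dvg p * coord 0 * hx - hD
  · linear_combination h0 + h1 + h2 + c0 + c2 + hj + hpj - p 1 * hx - coord 1 * hp'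
      + coord 1 * hd - 2 * dvg p * coord 1 * hx - hD
  · linear_combination h0 + h1 + h2 + c0 + c1 + hj + hpj - p 2 * hx - coord 2 * hp'
      + coord 2 * hd - 2 * dvg p * coord 2 * hx - hD

/-- The curl of the divergence of the conformal Killing operator is `½ (Δ + 2)` of the curl. -/
lemma crl_lap {p : Fin 3 → SmoothFun} :
    crl (fun j => lap (p j) + 2 * p j + 2 * (coord j * dvg p)) = lap (crl p) + 2 * crl p := by
  have e : ∀ q : Fin 3 → SmoothFun, crl q = (coord 1 * tanDeriv 2 (q 0) - coord 2 * tanDeriv 1 (q 0))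
      + (coord 2 * tanDeriv 0 (q 1) - coord 0 * tanDeriv 2 (q 1))
      + (coord 0 * tanDeriv 1 (q 2) - coord 1 * tanDeriv 0 (q 2)) := fun q => by
    simp only [crl]; ring
  have e2 : lap (crl p) = crl (fun j => lap (p j)) := by
    rw [e, e, lap_add, lap_add, lap_rotation, lap_rotation, lap_rotation]
  rw [e2]
  simp only [crl, map_add, Derivation.leibniz, smul_eq_mul, tanDeriv_two, tanDeriv_coord]
  simp
  ring

/-! ### Conformal frames and the two solvability results -/

/-- The constant function on `S²` with value `σ`. -/
def constFun (σ : ℝ) : SmoothFun := algebraMap ℝ SmoothFun σ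

@[simp] lemma constFun_apply (σ : ℝ) (x : S2) : constFun σ x = σ := by
  simp [constFun, Algebra.algebraMap_eq_smul_one]

@[simp] lemma tanDeriv_constFun (i : Fin 3) (σ : ℝ) : tanDeriv i (constFun σ) = 0 :=
  (tanDeriv i).map_algebraMap σ

lemma constFun_mul_self {σ : ℝ} (hσ : σ * σ = 1) : constFun σ * constFun σ = 1 := by
  rw [constFun, ← map_mul, hσ, map_one]

/-- The conformal factor `1 - σ x_2`, which vanishes exactly at the pole `(0, 0, σ)`. -/
def conf (σ : ℝ) : SmoothFun := 1 - constFun σ * coord 2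

lemma conf_apply (σ : ℝ) (x : S2) : conf σ x = 1 - σ * (x : E3) 2 := by
  simp [conf]

/-- A smooth function that vanishes away from a pole vanishes: the pole is not isolated. -/
lemma eq_zero_of_conf_mul {σ : ℝ} (hσ : σ * σ = 1) {u : SmoothFun} (h : conf σ * u = 0) : u = 0 := by
  have h1 : ∀ x : S2, σ * (x : E3) 2 ≠ 1 → u x = 0 := fun x hx => by
    have h2 := DFunLike.congr_fun h x
    rw [ContMDiffMap.coe_mul, Pi.mul_apply, conf_apply] at h2
    exact (mul_eq_zero.1 h2).resolve_left (sub_ne_zero.2 hx.symm)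
  have hrank : 1 < Module.rank ℝ E3 := by
    rw [← Module.finrank_eq_rank, finrank_euclideanSpace_fin]; norm_num
  have : ConnectedSpace S2 :=
    Subtype.connectedSpace (isConnected_sphere hrank 0 zero_le_one)
  have : Nontrivial S2 := ⟨⟨⟨e 0, by simp [e]⟩, ⟨e 1, by simp [e]⟩, fun h => by
    have := congrArg (fun x : S2 => (x : E3) 0) h
    simp [e] at this⟩⟩
  refine ContMDiffMap.ext fun x => ?_
  by_cases hx : σ * (x : E3) 2 = 1
  · have hne : ∀ y : S2, y ≠ x → u y = 0 := fun y hy => h1 y fun hy1 => hy (by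
      obtain ⟨a0, a1⟩ := coordinates_eq_zero hσ hx
      obtain ⟨b0, b1⟩ := coordinates_eq_zero hσ hy1
      ext i
      fin_cases i
      · exact b0.trans a0.symm
      · exact b1.trans a1.symm
      · change (y : E3) 2 = (x : E3) 2
        linear_combination σ * (hy1 - hx) - ((y : E3) 2 - (x : E3) 2) * hσ)
    have h3 : Tendsto u (𝓝[≠] x) (𝓝 (u x)) := u.contMDiff.continuous.continuousWithinAt
    have h4 : Tendsto u (𝓝[≠] x) (𝓝 0) :=
      tendsto_const_nhds.congr' (by
        filter_upwards [self_mem_nhdsWithin] with y hy using (hne y hy).symm)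
    exact tendsto_nhds_unique h3 h4
  · exact h1 x hx

/-- A tangential vector orthogonal to the conformal frame (see `frameA`, `frameB`) vanishes. -/
lemma eq_zero_of_frame {σ : ℝ} (hσ : σ * σ = 1) {q : Fin 3 → SmoothFun} (hq : IsTangential q)
    (hA : conf σ * q 0 + constFun σ * coord 0 * q 2 = 0)
    (hB : conf σ * q 1 + constFun σ * coord 1 * q 2 = 0) (j : Fin 3) : q j = 0 := by
  have hs := constFun_mul_self hσ
  have hx := sum_coord_sq
  have hq' : coord 0 * q 0 + coord 1 * q 1 + coord 2 * q 2 = 0 := hq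
  have h2 : q 2 = 0 := eq_zero_of_conf_mul hσ (by
    simp only [conf] at *
    set s := constFun σ
    linear_combination (-s * (1 - s * coord 2)) * hq' + s * coord 0 * hA + s * coord 1 * hB
      - s * s * q 2 * hx
      - q 2 * hs)
  have h0 : q 0 = 0 := eq_zero_of_conf_mul hσ (by rw [h2] at hA; linear_combination hA)
  have h1 : q 1 = 0 := eq_zero_of_conf_mul hσ (by rw [h2] at hB; linear_combination hB)
  fin_cases j
  · exact h0
  · exact h1
  · exact h2

/-- The first coordinate vector field of the stereographic chart from the pole `(0, 0, σ)`. -/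
def frameA (σ : ℝ) : Fin 3 → SmoothFun :=
  ![conf σ - coord 0 * coord 0, -(coord 0 * coord 1), constFun σ * coord 0 - coord 0 * coord 2]

/-- The second coordinate vector field of the stereographic chart from the pole `(0, 0, σ)`. -/
def frameB (σ : ℝ) : Fin 3 → SmoothFun :=
  ![-(coord 1 * coord 0), conf σ - coord 1 * coord 1, constFun σ * coord 1 - coord 1 * coord 2]

lemma isTangential_frameA (σ : ℝ) : IsTangential (frameA σ) := by
  have hx := sum_coord_sq
  simp only [IsTangential, frameA, conf, Matrix.cons_val]
  linear_combination (-coord 0) * hx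

lemma isTangential_frameB (σ : ℝ) : IsTangential (frameB σ) := by
  have hx := sum_coord_sq
  simp only [IsTangential, frameB, conf, Matrix.cons_val]
  linear_combination (-coord 1) * hx

lemma dvg_frameA (σ : ℝ) : dvg (frameA σ) = -2 * coord 0 := by
  have hx := sum_coord_sq
  simp only [dvg, frameA, conf, Matrix.cons_val, map_sub, map_neg, Derivation.leibniz, smul_eq_mul,
    tanDeriv_coord, tanDeriv_constFun]
  simp
  linear_combination 2 * coord 0 * hx

lemma dvg_frameB (σ : ℝ) : dvg (frameB σ) = -2 * coord 1 := by
  have hx := sum_coord_sq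
  simp only [dvg, frameB, conf, Matrix.cons_val, map_sub, map_neg, Derivation.leibniz, smul_eq_mul,
    tanDeriv_coord, tanDeriv_constFun]
  simp
  linear_combination 2 * coord 1 * hx

/-- The coordinate vector fields of the stereographic chart are conformal Killing fields. -/
lemma killing_frameA (σ : ℝ) (i j : Fin 3) : killing (frameA σ) i j = 0 := by
  rw [killing, dvg_frameA]
  simp only [covDeriv, metricComp]
  fin_cases i <;> fin_cases j <;>
    simp [frameA, conf, tanDeriv_coord] <;> ring

lemma killing_frameB (σ : ℝ) (i j : Fin 3) : killing (frameB σ) i j = 0 := by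
  rw [killing, dvg_frameB]
  simp only [covDeriv, metricComp]
  fin_cases i <;> fin_cases j <;>
    simp [frameB, conf, tanDeriv_coord] <;> ring

lemma killing_smul (u : SmoothFun) (q : Fin 3 → SmoothFun) (i j : Fin 3) :
    killing (u • q) i j = u * killing q i j + (tanDeriv j u * q i + tanDeriv i u * q j -
      (tanDeriv 0 u * q 0 + tanDeriv 1 u * q 1 + tanDeriv 2 u * q 2) * metricComp i j) := by
  simp only [killing, covDeriv, dvg, Pi.smul_apply, smul_eq_mul, Derivation.leibniz]
  ring

/-- The Cauchy–Riemann equations on the sphere, in the ring of smooth functions. -/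
lemma exists_cauchyRiemann' {σ : ℝ} (hσ : σ * σ = 1) (K t₁ t₂ : SmoothFun)
    (hK : ∀ x : S2, 1 / 2 ≤ σ * (x : E3) 2 → K x = 0) :
    ∃ u₁ u₂ : SmoothFun,
      (conf σ * tanDeriv 0 u₁ + constFun σ * coord 0 * tanDeriv 2 u₁) -
        (conf σ * tanDeriv 1 u₂ + constFun σ * coord 1 * tanDeriv 2 u₂) = K * t₁ ∧
      (conf σ * tanDeriv 0 u₂ + constFun σ * coord 0 * tanDeriv 2 u₂) +
        (conf σ * tanDeriv 1 u₁ + constFun σ * coord 1 * tanDeriv 2 u₁) = K * t₂ := by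
  obtain ⟨u₁, u₂, h⟩ := exists_cauchyRiemann hσ (K * t₁) (K * t₂)
    (fun x hx => by simp [hK x hx]) (fun x hx => by simp [hK x hx])
  refine ⟨u₁, u₂, ContMDiffMap.ext fun x => ?_, ContMDiffMap.ext fun x => ?_⟩
  · simpa [conf_apply] using (h x).1
  · simpa [conf_apply] using (h x).2

/-- Hodge decomposition of a one-form supported away from a pole. The factor `σ` in `G` accounts for
the orientation of the stereographic chart. -/
lemma exists_hodge_local {σ : ℝ} (hσ : σ * σ = 1) {K : SmoothFun}
    (hK : ∀ x : S2, 1 / 2 ≤ σ * (x : E3) 2 → K x = 0) {p : Fin 3 → SmoothFun}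
    (hp : IsTangential p) :
    ∃ F G : SmoothFun, K • p = grad F + cross (grad G) := by
  have hs := constFun_mul_self hσ
  have hx := sum_coord_sq
  obtain ⟨u₁, u₂, h1, h2⟩ := exists_cauchyRiemann' hσ K
    (conf σ * p 0 + constFun σ * coord 0 * p 2) (conf σ * p 1 + constFun σ * coord 1 * p 2) hK
  have hσu : ∀ i, tanDeriv i (constFun σ * u₂) = constFun σ * tanDeriv i u₂ := fun i => by
    simp [Derivation.leibniz]
  refine ⟨u₁, -(constFun σ * u₂), ?_⟩
  have hu := sum_coord_mul_tanDeriv u₂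
  have hq : IsTangential (K • p - (grad u₁ + cross (grad (-(constFun σ * u₂))))) :=
    (hp.smul K).sub ((isTangential_grad _).add (isTangential_cross _))
  rw [← sub_eq_zero]
  ext1 j
  refine eq_zero_of_frame hσ hq ?_ ?_ j
  · simp only [Pi.sub_apply, Pi.add_apply, Pi.smul_apply, smul_eq_mul, cross_zero, cross_two, grad,
      map_neg, hσu]
    simp only [conf] at h1 ⊢
    set s := constFun σ
    linear_combination -h1 - s * s * coord 1 * hu + s * s * tanDeriv 1 u₂ * hx +
      (s * (coord 2 * tanDeriv 1 u₂ - coord 1 * tanDeriv 2 u₂) +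
        ((1 - s * coord 2) * tanDeriv 1 u₂ + s * coord 1 * tanDeriv 2 u₂)) * hs
  · simp only [Pi.sub_apply, Pi.add_apply, Pi.smul_apply, smul_eq_mul, cross_one, cross_two, grad,
      map_neg, hσu]
    simp only [conf] at h2 ⊢
    set s := constFun σ
    linear_combination -h2 + s * s * coord 0 * hu - s * s * tanDeriv 0 u₂ * hx -
      (s * (coord 2 * tanDeriv 0 u₂ - coord 0 * tanDeriv 2 u₂) +
        ((1 - s * coord 2) * tanDeriv 0 u₂ + s * coord 0 * tanDeriv 2 u₂)) * hs

/-- Components of symmetric traceless tangential two-tensors. -/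
structure IsTraceFree (Q : Fin 3 → Fin 3 → SmoothFun) : Prop where
  symm : ∀ i j, Q i j = Q j i
  tangential : ∀ j, IsTangential fun i => Q i j
  trace : Q 0 0 + Q 1 1 + Q 2 2 = 0

lemma IsTraceFree.sub {Q R : Fin 3 → Fin 3 → SmoothFun} (hQ : IsTraceFree Q) (hR : IsTraceFree R) :
    IsTraceFree (Q - R) where
  symm i j := by simp only [Pi.sub_apply, hQ.symm i j, hR.symm i j]
  tangential j := (hQ.tangential j).sub (hR.tangential j)
  trace := by simp only [Pi.sub_apply]; linear_combination hQ.trace - hR.trace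

lemma IsTraceFree.smul {Q : Fin 3 → Fin 3 → SmoothFun} (hQ : IsTraceFree Q) (u : SmoothFun) :
    IsTraceFree (u • Q) where
  symm i j := by simp only [Pi.smul_apply, hQ.symm i j]
  tangential j := (hQ.tangential j).smul u
  trace := by simp only [Pi.smul_apply, smul_eq_mul]; linear_combination u * hQ.trace

lemma isTraceFree_killing {p : Fin 3 → SmoothFun} (hp : IsTangential p) :
    IsTraceFree (killing p) where
  symm i j := by simp only [killing, metricComp_comm i j]; ring
  tangential j := by
    have h1 := hp.sum_coord_mul_tanDeriv j
    have h2 := SphereTensor.sum_coord_mul_tanDeriv (p j)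
    have hp' : coord 0 * p 0 + coord 1 * p 1 + coord 2 * p 2 = 0 := hp
    have hx := sum_coord_sq
    simp only [IsTangential, killing, covDeriv, metricComp]
    fin_cases j <;> simp at h1 h2 ⊢
    · linear_combination h1 + h2 + (p 0 + dvg p * coord 0) * hx + coord 0 * hp'
    · linear_combination h1 + h2 + (p 1 + dvg p * coord 1) * hx + coord 1 * hp'
    · linear_combination h1 + h2 + (p 2 + dvg p * coord 2) * hx + coord 2 * hp'
  trace := by
    have hp' : coord 0 * p 0 + coord 1 * p 1 + coord 2 * p 2 = 0 := hp
    have hx := sum_coord_sq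
    simp only [killing, covDeriv, metricComp, dvg]
    simp
    linear_combination 2 * hp' +
      (tanDeriv 0 (p 0) + tanDeriv 1 (p 1) + tanDeriv 2 (p 2)) * hx

/-- A symmetric traceless tangential two-tensor is determined by two of its components in a
conformal frame. -/
lemma IsTraceFree.eq_zero_of_frame {σ : ℝ} (hσ : σ * σ = 1) {Q : Fin 3 → Fin 3 → SmoothFun}
    (hQ : IsTraceFree Q)
    (hA : conf σ * (conf σ * Q 0 0 + constFun σ * coord 0 * Q 2 0) +
      constFun σ * coord 0 * (conf σ * Q 0 2 + constFun σ * coord 0 * Q 2 2) = 0)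
    (hB : conf σ * (conf σ * Q 0 1 + constFun σ * coord 0 * Q 2 1) +
      constFun σ * coord 1 * (conf σ * Q 0 2 + constFun σ * coord 0 * Q 2 2) = 0)
    (i j : Fin 3) : Q i j = 0 := by
  have hs := constFun_mul_self hσ
  have hx := sum_coord_sq
  have t0 : coord 0 * Q 0 0 + coord 1 * Q 1 0 + coord 2 * Q 2 0 = 0 := hQ.tangential 0
  have t1 : coord 0 * Q 0 1 + coord 1 * Q 1 1 + coord 2 * Q 2 1 = 0 := hQ.tangential 1
  have t2 : coord 0 * Q 0 2 + coord 1 * Q 1 2 + coord 2 * Q 2 2 = 0 := hQ.tangential 2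
  have ht := hQ.trace
  have s01 := hQ.symm 0 1
  have s02 := hQ.symm 0 2
  have s12 := hQ.symm 1 2
  rw [← s01, ← s02] at t0
  rw [← s12] at t1
  -- the contractions of `Q` with the two frame vectors vanish
  have rA : ∀ j, conf σ * Q 0 j + constFun σ * coord 0 * Q 2 j = 0 := by
    refine fun j => SphereTensor.eq_zero_of_frame hσ
      (q := fun j => conf σ * Q 0 j + constFun σ * coord 0 * Q 2 j) ?_ hA hB j
    simp only [IsTangential, ← s02, ← s12]
    linear_combination conf σ * t0 + constFun σ * coord 0 * t2
  have rB : ∀ j, conf σ * Q 1 j + constFun σ * coord 1 * Q 2 j = 0 := by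
    refine fun j => SphereTensor.eq_zero_of_frame hσ
      (q := fun j => conf σ * Q 1 j + constFun σ * coord 1 * Q 2 j) ?_ ?_ ?_ j
    · simp only [IsTangential, ← s01, ← s02, ← s12]
      linear_combination conf σ * t1 + constFun σ * coord 1 * t2
    · simp only [← s01, ← s02, ← s12] at hB ⊢
      linear_combination hB
    · simp only [← s02, ← s12] at hA hB ⊢
      simp only [conf] at *
      set s := constFun σ
      -- the trace in the frame is `(1 - σ x_2)²` times the full trace
      linear_combination (1 - s * coord 2) ^ 2 * ht - hA + 2 * (1 - s * coord 2) * s * t2 +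
        s * s * Q 2 2 * hx + Q 2 2 * hs
  exact SphereTensor.eq_zero_of_frame hσ (hQ.tangential j) (rA j) (rB j) i

/-- Solution of the conformal Killing equation for a right-hand side supported away from a pole, in the
frame of coordinate vector fields of the chart. These have length `1 - σ x_2`, whence the factor
`conf σ ^ 2` on the right-hand side. -/
lemma exists_killing_local {σ : ℝ} (hσ : σ * σ = 1) {K : SmoothFun}
    (hK : ∀ x : S2, 1 / 2 ≤ σ * (x : E3) 2 → K x = 0) {S : Fin 3 → Fin 3 → SmoothFun}
    (hS : IsTraceFree S) :
    ∃ p : Fin 3 → SmoothFun, IsTangential p ∧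
      ∀ i j, 2 * (K * conf σ ^ 2 * S i j) = killing p i j := by
  have hs := constFun_mul_self hσ
  obtain ⟨u₁, u₂, h1, h2⟩ := exists_cauchyRiemann' hσ K
    (2 * (conf σ * (conf σ * S 0 0 + constFun σ * coord 0 * S 2 0) +
      constFun σ * coord 0 * (conf σ * S 0 2 + constFun σ * coord 0 * S 2 2)))
    (2 * (conf σ * (conf σ * S 0 1 + constFun σ * coord 0 * S 2 1) +
      constFun σ * coord 1 * (conf σ * S 0 2 + constFun σ * coord 0 * S 2 2))) hK
  have k1 := sum_coord_mul_tanDeriv u₁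
  have k2 := sum_coord_mul_tanDeriv u₂
  have hp : IsTangential (u₁ • frameA σ + u₂ • frameB σ) :=
    ((isTangential_frameA σ).smul u₁).add ((isTangential_frameB σ).smul u₂)
  refine ⟨_, hp, fun i j => ?_⟩
  have hQ : IsTraceFree ((2 * (K * conf σ ^ 2)) • S - killing (u₁ • frameA σ + u₂ • frameB σ)) :=
    (hS.smul _).sub (isTraceFree_killing hp)
  have h := hQ.eq_zero_of_frame hσ ?_ ?_ i j
  · simp only [Pi.sub_apply, Pi.smul_apply, smul_eq_mul] at h
    linear_combination h
  · simp only [Pi.sub_apply, Pi.smul_apply, smul_eq_mul, killing_add, killing_smul,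
      killing_frameA, killing_frameB, metricComp]
    simp [frameA, frameB]
    simp only [conf] at *
    set s := constFun σ
    linear_combination -(1 - s * coord 2) ^ 2 * h1 -
      ((1 - s * coord 2) ^ 2 + (s * s - 1) * coord 0 ^ 2) * (coord 0 * k1 + coord 1 * k2) -
      (coord 0 ^ 2 * (((1 - s * coord 2) * tanDeriv 0 u₁ + s * coord 0 * tanDeriv 2 u₁) -
          ((1 - s * coord 2) * tanDeriv 1 u₂ + s * coord 1 * tanDeriv 2 u₂)) +
        2 * coord 0 * coord 1 *
          ((1 - s * coord 2) * tanDeriv 0 u₂ + s * coord 0 * tanDeriv 2 u₂)) * hs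
  · simp only [Pi.sub_apply, Pi.smul_apply, smul_eq_mul, killing_add, killing_smul,
      killing_frameA, killing_frameB, metricComp]
    simp [frameA, frameB]
    simp only [conf] at *
    set s := constFun σ
    linear_combination -(1 - s * coord 2) ^ 2 * h2 -
      (s * s - 1) * coord 0 * coord 1 * (coord 0 * k1 + coord 1 * k2) -
      (coord 0 ^ 2 * ((1 - s * coord 2) * tanDeriv 1 u₁ + s * coord 1 * tanDeriv 2 u₁) +
        coord 1 ^ 2 * ((1 - s * coord 2) * tanDeriv 0 u₂ + s * coord 0 * tanDeriv 2 u₂)) * hs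

/-- A smooth cutoff function on the line that is zero on `[1/2, ∞)`, divided by `(1 - t)²`. At `t = 1`
the numerator vanishes, so the value of the inverse there does not matter. -/
def cutoff (t : ℝ) : ℝ := Real.smoothTransition (1 / 2 - t) * ((1 - t) ^ 2)⁻¹

lemma cutoff_eq_zero {t : ℝ} (ht : 1 / 2 ≤ t) : cutoff t = 0 := by
  rw [cutoff, Real.smoothTransition.zero_of_nonpos (by linarith), zero_mul]

lemma cutoff_mul (t : ℝ) : cutoff t * (1 - t) ^ 2 = Real.smoothTransition (1 / 2 - t) := by
  by_cases ht : t = 1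
  · rw [ht, Real.smoothTransition.zero_of_nonpos (by norm_num)]; simp
  · have : 1 - t ≠ 0 := sub_ne_zero.2 (Ne.symm ht)
    rw [cutoff]; field_simp

lemma contDiff_cutoff : ContDiff ℝ ∞ cutoff := by
  rw [contDiff_iff_contDiffAt]
  intro t
  rcases lt_or_ge t 1 with ht | ht
  · have h1 : (1 - t) ^ 2 ≠ 0 := pow_ne_zero _ (by linarith)
    exact (Real.smoothTransition.contDiff.comp (contDiff_const.sub contDiff_id)).contDiffAt.mul
      (((contDiff_const.sub contDiff_id).pow 2).contDiffAt.inv h1)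
  · refine (contDiffAt_const (c := (0 : ℝ))).congr_of_eventuallyEq ?_
    filter_upwards [lt_mem_nhds (show (1 / 2 : ℝ) < t by linarith)] with y hy
    exact cutoff_eq_zero hy.le

lemma smoothTransition_add (t : ℝ) :
    Real.smoothTransition (1 / 2 - t) + Real.smoothTransition (1 / 2 + t) = 1 := by
  have h1 := (Real.smoothTransition.pos_denom (1 / 2 - t)).ne'
  have e1 : (1 : ℝ) - (1 / 2 - t) = 1 / 2 + t := by ring
  have e2 : (1 : ℝ) - (1 / 2 + t) = 1 / 2 - t := by ring
  rw [Real.smoothTransition, Real.smoothTransition, e2, e1, add_comm (expNegInvGlue (1 / 2 + t)),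
    ← add_div]
  rw [e1] at h1
  exact div_self h1

/-- A partition of unity of the form `1 = K₁ (1 - x_2)² + K₂ (1 + x_2)²`, where each `K` vanishes
near the corresponding pole. -/
lemma exists_partition : ∃ K₁ K₂ : SmoothFun,
    (∀ x : S2, 1 / 2 ≤ 1 * (x : E3) 2 → K₁ x = 0) ∧
    (∀ x : S2, 1 / 2 ≤ -1 * (x : E3) 2 → K₂ x = 0) ∧
    K₁ * conf 1 ^ 2 + K₂ * conf (-1) ^ 2 = 1 := by
  have h : ContDiff ℝ ∞ fun t => cutoff (-t) := contDiff_cutoff.comp contDiff_neg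
  refine ⟨⟨fun x => cutoff ((x : E3) 2), contDiff_cutoff.contMDiff.comp (coord 2).contMDiff⟩,
    ⟨fun x => cutoff (-(x : E3) 2), h.contMDiff.comp (coord 2).contMDiff⟩, ?_, ?_, ?_⟩
  · intro x hx
    exact cutoff_eq_zero (by linarith)
  · intro x hx
    exact cutoff_eq_zero (by linarith)
  · ext x
    have h1 := cutoff_mul ((x : E3) 2)
    have h2 := cutoff_mul (-(x : E3) 2)
    have h3 := smoothTransition_add ((x : E3) 2)
    change cutoff ((x : E3) 2) * conf 1 x ^ 2 + cutoff (-(x : E3) 2) * conf (-1) x ^ 2 = 1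
    rw [conf_apply, conf_apply, one_mul, neg_one_mul, h1, h2, sub_neg_eq_add, h3]

/-- The conformal Killing operator is onto the symmetric traceless two-tensors. -/
theorem exists_killing {S : Fin 3 → Fin 3 → SmoothFun} (hS : IsTraceFree S) :
    ∃ p : Fin 3 → SmoothFun, IsTangential p ∧ ∀ i j, 2 * S i j = killing p i j := by
  obtain ⟨K₁, K₂, h1, h2, h⟩ := exists_partition
  obtain ⟨p₁, hp₁, e₁⟩ := exists_killing_local (by norm_num) h1 hS
  obtain ⟨p₂, hp₂, e₂⟩ := exists_killing_local (by norm_num) h2 hS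
  refine ⟨p₁ + p₂, hp₁.add hp₂, fun i j => ?_⟩
  rw [killing_add, ← e₁, ← e₂]
  linear_combination (-2 * S i j) * h

/-- Closed one-forms on the sphere are exact. The Hodge decomposition `p = ∇F + x × ∇G` is solvable
by the Cauchy–Riemann equations, and `p` being closed means that `G` is harmonic. -/
theorem exists_grad_of_crl_eq_zero {p : Fin 3 → SmoothFun} (hp : IsTangential p)
    (hc : crl p = 0) : ∃ f : SmoothFun, p = grad f := by
  obtain ⟨K₁, K₂, h1, h2, h⟩ := exists_partition
  obtain ⟨F₁, G₁, e₁⟩ := exists_hodge_local (σ := 1) (K := K₁ * conf 1 ^ 2) (by norm_num)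
    (fun x hx => by simp [h1 x hx]) hp
  obtain ⟨F₂, G₂, e₂⟩ := exists_hodge_local (σ := -1) (K := K₂ * conf (-1) ^ 2) (by norm_num)
    (fun x hx => by simp [h2 x hx]) hp
  have hg : ∀ u v, grad (u + v) = grad u + grad v := fun u v => by
    ext1 i; simp [grad]
  have hcr : ∀ q r, cross (q + r) = cross q + cross r := fun q r => by
    ext1 i; fin_cases i <;> simp <;> ring
  have e : p = grad (F₁ + F₂) + cross (grad (G₁ + G₂)) := by
    rw [hg, hg, hcr, add_add_add_comm, ← e₁, ← e₂, ← add_smul, h, one_smul]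
  have hG : lap (G₁ + G₂) = 0 := by
    rw [← dvg_grad, ← crl_cross (isTangential_grad _), ← hc, e, crl_add, crl_grad, zero_add]
  obtain ⟨c, hcst⟩ := eq_const_of_lap_eq_zero hG
  have hG' : grad (G₁ + G₂) = 0 := by
    have : G₁ + G₂ = constFun c := ContMDiffMap.ext fun x => by rw [hcst, constFun_apply]
    ext1 i
    simp only [grad, this, tanDeriv_constFun, Pi.zero_apply]
  refine ⟨F₁ + F₂, ?_⟩
  rw [hG'] at e
  rw [e]
  ext1 i
  fin_cases i <;> simp

/-! ### Kernels and potentials -/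

lemma covDeriv_grad_comm (u : SmoothFun) (i j : Fin 3) :
    covDeriv (grad u) i j = covDeriv (grad u) j i :=
  covDeriv_comm_of_crl_eq_zero (isTangential_grad u) (crl_grad u) i j

lemma tanDeriv_linFun (b : E3) (i : Fin 3) :
    tanDeriv i (linFun b) = constFun (b i) - coord i * linFun b := by
  have h : ∀ (c : ℝ) (u : SmoothFun), c • u = constFun c * u := fun c u => by
    rw [constFun, Algebra.smul_def]
  simp only [linFun, h, map_add, Derivation.leibniz, smul_eq_mul, tanDeriv_constFun, tanDeriv_coord]
  fin_cases i <;> simp <;> ring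

/-- The covariant Hessian of a linear function is a multiple of the metric. -/
lemma covDeriv_grad_linFun (b : E3) (i j : Fin 3) :
    covDeriv (grad (linFun b)) i j = -(linFun b * metricComp i j) := by
  simp only [covDeriv, grad, tanDeriv_linFun, map_sub, Derivation.leibniz, smul_eq_mul,
    tanDeriv_constFun, tanDeriv_coord']
  ring

lemma killing_grad_linFun (b : E3) (i j : Fin 3) : killing (grad (linFun b)) i j = 0 := by
  rw [killing, dvg_grad, lap_linFun, covDeriv_grad_linFun, covDeriv_grad_linFun,
    metricComp_comm j i]
  ring

/-- The rotation fields are Killing fields. -/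
lemma killing_cross_grad_linFun (b : E3) (i j : Fin 3) :
    killing (cross (grad (linFun b))) i j = 0 := by
  have hd : dvg (cross (grad (linFun b))) = 0 := by rw [dvg_cross, crl_grad, neg_zero]
  rw [killing, hd]
  simp only [covDeriv]
  fin_cases i <;> fin_cases j <;>
    simp [grad, tanDeriv_linFun, tanDeriv_coord] <;> ring

/-- The trace-free Hessian annihilates exactly the spherical harmonics of degree at most one. If it
annihilates `u`, taking its divergence shows that `Δu + 2u` is constant. -/
theorem killing_grad_eq_zero_iff (u : SmoothFun) :
    (∀ i j, killing (grad u) i j = 0) ↔ ∃ (a : ℝ) (b : E3), u = constFun a + linFun b := by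
  constructor
  · intro h
    have h1 : ∀ j, tanDeriv j (lap u + 2 * u) = 0 := fun j => by
      have h2 := two_mul_dvgTwo (S := 0) (isTangential_grad u) (fun i j => by simp [h i j]) j
      simp only [dvg_grad, grad, lap_tanDeriv, dvgTwo, Pi.zero_apply, map_zero] at h2
      simp only [map_add, Derivation.leibniz, tanDeriv_two, smul_eq_mul]
      linear_combination -h2
    obtain ⟨c, hc⟩ := SmoothFun.eq_const_of_tanDeriv_eq_zero h1
    have hc' : lap u + 2 * u = constFun c := ContMDiffMap.ext fun x => by rw [hc, constFun_apply]
    have h2c : 2 * constFun (c / 2) = constFun c := ContMDiffMap.ext fun x => by simp; ring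
    have hlc : lap (constFun (c / 2)) = 0 := by simp [lap]
    obtain ⟨b, hb⟩ := eq_linFun_of_lap (w := u - constFun (c / 2)) (by
      rw [lap_sub, hlc]; linear_combination hc' - h2c)
    exact ⟨c / 2, b, by rw [← hb]; ring⟩
  · rintro ⟨a, b, rfl⟩ i j
    have hg : grad (constFun a + linFun b) = grad (linFun b) := by
      ext1 k; simp [grad]
    rw [hg, killing_grad_linFun]

/-- The divergence of the trace-free Hessian of `f` is `½ ∇(Δf + 2f)`. -/
lemma dvgTwo_of_grad {S : Fin 3 → Fin 3 → SmoothFun} {f : SmoothFun}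
    (h : ∀ i j, 2 * S i j = killing (grad f) i j) (j : Fin 3) :
    2 * dvgTwo S j = tanDeriv j (lap f + 2 * f) := by
  rw [two_mul_dvgTwo (isTangential_grad f) h j]
  simp only [dvg_grad, grad, lap_tanDeriv, map_add, Derivation.leibniz, tanDeriv_two, smul_eq_mul]
  ring

lemma killing_grad_sub (u v : SmoothFun) (i j : Fin 3) :
    killing (grad (u - v)) i j = killing (grad u) i j - killing (grad v) i j := by
  rw [← killing_sub]
  congr 1
  ext1 k
  exact map_sub _ u v

lemma two_mul_dvg_of_grad {p : Fin 3 → SmoothFun} {u : SmoothFun} (h : ∀ i, 2 * p i = grad u i) :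
    2 * dvg p = lap u := by
  rw [two_mul, ← dvg_add, ← dvg_grad]
  congr 1
  ext1 i
  rw [Pi.add_apply, ← two_mul, h]

/-- If the divergence of `S` is closed, every potential of `S` is closed up to a rotation field:
its curl is an eigenfunction of the Laplacian for the eigenvalue `-2`. -/
theorem exists_crl_sub_eq_zero {S : Fin 3 → Fin 3 → SmoothFun} {p : Fin 3 → SmoothFun}
    (hp : IsTangential p) (h : ∀ i j, 2 * S i j = killing p i j) (hc : crl (dvgTwo S) = 0) :
    ∃ b : E3, crl (p - cross (grad (linFun b))) = 0 := by
  have h1 : lap (crl p) + 2 * crl p = 0 := by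
    rw [← crl_lap]
    have : (fun j => lap (p j) + 2 * p j + 2 * (coord j * dvg p)) = dvgTwo S + dvgTwo S := by
      ext1 j
      rw [← two_mul_dvgTwo hp h j, Pi.add_apply, two_mul]
    rw [this, crl_add, hc, add_zero]
  obtain ⟨b, hb⟩ := eq_linFun_of_lap h1
  refine ⟨(-(1 / 2) : ℝ) • b, ?_⟩
  have e : -2 * linFun ((-(1 / 2) : ℝ) • b) = linFun b := ContMDiffMap.ext fun x => by
    simp [linFun]; ring
  rw [crl_sub, crl_cross (isTangential_grad _), dvg_grad, lap_linFun, e, hb, sub_self]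

/-- A symmetric traceless two-tensor with closed divergence is a trace-free Hessian. -/
theorem exists_killing_grad {S : Fin 3 → Fin 3 → SmoothFun} (hS : IsTraceFree S)
    (hc : crl (dvgTwo S) = 0) : ∃ f : SmoothFun, ∀ i j, 2 * S i j = killing (grad f) i j := by
  obtain ⟨p, hp, h⟩ := exists_killing hS
  obtain ⟨b, hb⟩ := exists_crl_sub_eq_zero hp h hc
  obtain ⟨f, hf⟩ := exists_grad_of_crl_eq_zero (hp.sub (isTangential_cross _)) hb
  refine ⟨f, fun i j => ?_⟩
  rw [← hf, killing_sub, killing_cross_grad_linFun, sub_zero, h]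

/-! ### Duality between closed and co-closed divergence -/

/-- The tensor obtained by applying the Hodge dual to the first index. -/
def dualTensor (Q : Fin 3 → Fin 3 → SmoothFun) (i j : Fin 3) : SmoothFun := cross (fun k => Q k j) i

/-- The antisymmetric part of the dual of a symmetric tensor is a multiple of the area form. -/
lemma dualTensor_sub_dualTensor {Q : Fin 3 → Fin 3 → SmoothFun} (hs : ∀ i j, Q i j = Q j i)
    (ht : ∀ j, IsTangential fun i => Q i j) (i j : Fin 3) :
    dualTensor Q i j - dualTensor Q j i =
      (Q 0 0 + Q 1 1 + Q 2 2) * dualTensor metricComp i j := by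
  have t0 : coord 0 * Q 0 0 + coord 1 * Q 1 0 + coord 2 * Q 2 0 = 0 := ht 0
  have t1 : coord 0 * Q 0 1 + coord 1 * Q 1 1 + coord 2 * Q 2 1 = 0 := ht 1
  have t2 : coord 0 * Q 0 2 + coord 1 * Q 1 2 + coord 2 * Q 2 2 = 0 := ht 2
  have s10 := hs 1 0
  have s20 := hs 2 0
  have s21 := hs 2 1
  rw [s10, s20] at t0
  rw [s21] at t1
  simp only [dualTensor]
  fin_cases i <;> fin_cases j <;> simp [metricComp] <;> try simp only [s10, s20, s21]
  · ring
  · linear_combination t2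
  · linear_combination -t1
  · linear_combination -t2
  · ring
  · linear_combination t0
  · linear_combination t1
  · linear_combination -t0
  · ring

lemma isTraceFree_dualTensor {Q : Fin 3 → Fin 3 → SmoothFun} (hQ : IsTraceFree Q) :
    IsTraceFree (dualTensor Q) where
  symm i j := by
    have h := dualTensor_sub_dualTensor hQ.symm hQ.tangential i j
    rw [hQ.trace, zero_mul] at h
    exact sub_eq_zero.1 h
  tangential j := isTangential_cross _
  trace := by
    have s10 := hQ.symm 1 0
    have s20 := hQ.symm 2 0
    have s21 := hQ.symm 2 1
    simp only [dualTensor, cross_zero, cross_one, cross_two, s10, s20, s21]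
    ring

lemma cross_cross {q : Fin 3 → SmoothFun} (hq : IsTangential q) (i : Fin 3) :
    cross (cross q) i = -q i := by
  have hx := sum_coord_sq
  have hq' : coord 0 * q 0 + coord 1 * q 1 + coord 2 * q 2 = 0 := hq
  fin_cases i <;> simp
  · linear_combination coord 0 * hq' - q 0 * hx
  · linear_combination coord 1 * hq' - q 1 * hx
  · linear_combination coord 2 * hq' - q 2 * hx

lemma dualTensor_dualTensor {Q : Fin 3 → Fin 3 → SmoothFun} (hQ : IsTraceFree Q) (i j : Fin 3) :
    dualTensor (dualTensor Q) i j = -Q i j :=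
  cross_cross (hQ.tangential j) i

lemma isTangential_dvgTwo {Q : Fin 3 → Fin 3 → SmoothFun} (hQ : IsTraceFree Q) :
    IsTangential (dvgTwo Q) := by
  have h := fun i => (hQ.tangential i).sum_coord_mul_tanDeriv i
  have h0 := h 0
  have h1 := h 1
  have h2 := h 2
  have s10 := hQ.symm 1 0
  have s20 := hQ.symm 2 0
  have s21 := hQ.symm 2 1
  simp only [IsTangential, dvgTwo]
  simp only [s10, s20, s21] at *
  linear_combination h0 + h1 + h2 - hQ.trace

/-- The divergence of the dual tensor is the Hodge dual of the divergence; in particular it is closed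
if and only if the divergence is co-closed. -/
lemma dvgTwo_dualTensor {Q : Fin 3 → Fin 3 → SmoothFun} (hQ : IsTraceFree Q) :
    dvgTwo (dualTensor Q) = cross (dvgTwo Q) := by
  have hs := (isTraceFree_dualTensor hQ).symm
  have s10 := hQ.symm 1 0
  have s20 := hQ.symm 2 0
  have s21 := hQ.symm 2 1
  ext1 j
  simp only [dvgTwo]
  rw [hs 0 j, hs 1 j, hs 2 j]
  simp only [dualTensor]
  have t0 : coord 0 * Q 0 0 + coord 1 * Q 1 0 + coord 2 * Q 2 0 = 0 := hQ.tangential 0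
  have t1 : coord 0 * Q 0 1 + coord 1 * Q 1 1 + coord 2 * Q 2 1 = 0 := hQ.tangential 1
  have t2 : coord 0 * Q 0 2 + coord 1 * Q 1 2 + coord 2 * Q 2 2 = 0 := hQ.tangential 2
  rw [s10, s20] at t0
  rw [s21] at t1
  fin_cases j <;> simp [tanDeriv_coord, dvgTwo] <;> simp only [s10, s20, s21]
  · linear_combination coord 2 * t1 - coord 1 * t2
  · linear_combination coord 0 * t2 - coord 2 * t0
  · linear_combination coord 1 * t0 - coord 0 * t1

/-- The rotated Hessian of `g` is the dual of its trace-free Hessian. -/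
lemma dualTensor_killing_grad (g : SmoothFun) (i j : Fin 3) :
    dualTensor (killing (grad g)) i j =
      cross (fun k => covDeriv (grad g) j k) i + cross (fun k => covDeriv (grad g) i k) j := by
  have hc := covDeriv_grad_comm g
  have ht : ∀ j, IsTangential fun i => covDeriv (grad g) i j := fun j => by
    have h1 := sum_coord_mul_tanDeriv (grad g j)
    have h2 := sum_coord_mul_tanDeriv g
    simp only [IsTangential, covDeriv, grad] at *
    linear_combination h1 + coord j * h2
  have htr : covDeriv (grad g) 0 0 + covDeriv (grad g) 1 1 + covDeriv (grad g) 2 2 =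
      dvg (grad g) := by
    have h2 := sum_coord_mul_tanDeriv g
    simp only [covDeriv, dvg, grad]
    linear_combination h2
  have h := dualTensor_sub_dualTensor hc ht i j
  rw [htr] at h
  have e : ∀ i j, cross (fun k => covDeriv (grad g) j k) i = dualTensor (covDeriv (grad g)) i j :=
    fun i j => by simp only [dualTensor, hc j]
  have e2 : dualTensor (killing (grad g)) i j = 2 * dualTensor (covDeriv (grad g)) i j -
      dvg (grad g) * dualTensor metricComp i j := by
    simp only [dualTensor, killing, hc j]
    fin_cases i <;> simp <;> ring
  rw [e, e, e2]
  linear_combination h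

/-- Representing `S` by the rotated Hessian of `g` is the same as representing its dual by the
trace-free Hessian of `-g`. -/
lemma rotated_hessian_iff {S : Fin 3 → Fin 3 → SmoothFun} (hS : IsTraceFree S) (g : SmoothFun) :
    (∀ i j, 2 * S i j = cross (fun k => covDeriv (grad g) j k) i +
      cross (fun k => covDeriv (grad g) i k) j) ↔
    ∀ i j, 2 * dualTensor S i j = killing (grad (-g)) i j := by
  have hneg : ∀ i j, killing (grad (-g)) i j = -killing (grad g) i j := fun i j => by
    simp only [killing, covDeriv, dvg, grad, map_neg]; ring
  have hk := isTraceFree_killing (isTangential_grad g)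
  have hsm : ∀ (c : SmoothFun) (Q : Fin 3 → Fin 3 → SmoothFun) (i j : Fin 3),
      c * dualTensor Q i j = dualTensor (fun i j => c * Q i j) i j := fun c Q i j => by
    simp only [dualTensor]
    fin_cases i <;> simp <;> ring
  simp only [← dualTensor_killing_grad, hneg]
  constructor
  · intro h i j
    rw [hsm, show (fun i j => 2 * S i j) = dualTensor (killing (grad g)) from
      funext fun i => funext fun j => h i j, dualTensor_dualTensor hk]
  · intro h i j
    have h1 := dualTensor_dualTensor hS i j
    have h2 : killing (grad g) = fun i j => -2 * dualTensor S i j :=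
      funext fun i => funext fun j => by linear_combination h i j
    rw [h2, ← hsm, h1]
    ring

/-! ### Tensors on the sphere and their components -/

/-- The smooth functions `q i` are the components of the one-form `p`. -/
def HasComp (p : S2 → E3 →L[ℝ] ℝ) (q : Fin 3 → SmoothFun) : Prop := ∀ x i, p x (e i) = q i x

/-- The smooth functions `Q i j` are the components of the two-tensor `S`. -/
def HasComp₂ (S : S2 → E3 →L[ℝ] E3 →L[ℝ] ℝ) (Q : Fin 3 → Fin 3 → SmoothFun) : Prop :=
  ∀ x i j, S x (e i) (e j) = Q i j x

lemma clm_ext {L L' : E3 →L[ℝ] ℝ} (h : ∀ i, L (e i) = L' (e i)) : L = L' := by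
  ext v
  rw [eq_sum_e v, map_sum, map_sum]
  simp [h]

lemma bilin_apply (B : E3 →L[ℝ] E3 →L[ℝ] ℝ) (v w : E3) :
    B v w = ∑ i, ∑ j, v i * w j * B (e i) (e j) := by
  conv_lhs => rw [eq_sum_e v, eq_sum_e w]
  simp only [map_sum, map_smul, sum_apply, smul_apply, smul_eq_mul,
    Finset.mul_sum]
  rw [Finset.sum_comm]
  refine Finset.sum_congr rfl fun i _ => Finset.sum_congr rfl fun j _ => by ring

/-- The one-form with given components. -/
def toForm (q : Fin 3 → SmoothFun) (x : S2) : E3 →L[ℝ] ℝ := ∑ i, q i x • EuclideanSpace.proj i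

lemma hasComp_toForm (q : Fin 3 → SmoothFun) : HasComp (toForm q) q := fun x i => by
  simp [toForm, e]

lemma HasComp.eq_toForm {p : S2 → E3 →L[ℝ] ℝ} {q : Fin 3 → SmoothFun} (h : HasComp p q) :
    p = toForm q :=
  funext fun x => clm_ext fun i => by rw [h x i, hasComp_toForm q x i]

lemma HasComp.isSmooth {p : S2 → E3 →L[ℝ] ℝ} {q : Fin 3 → SmoothFun} (h : HasComp p q) :
    IsSmooth p := by
  rw [h.eq_toForm]
  have hi : ∀ i, ContMDiff (𝓡 2) 𝓘(ℝ, E3 →L[ℝ] ℝ) ∞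
      (fun x : S2 => q i x • (EuclideanSpace.proj i : E3 →L[ℝ] ℝ)) := fun i =>
    (((ContinuousLinearMap.id ℝ ℝ).smulRight
      (EuclideanSpace.proj i : E3 →L[ℝ] ℝ)).contDiff.contMDiff).comp (q i).contMDiff
  have : toForm q = fun x => q 0 x • (EuclideanSpace.proj 0 : E3 →L[ℝ] ℝ) +
      q 1 x • EuclideanSpace.proj 1 + q 2 x • EuclideanSpace.proj 2 := funext fun x => by
    rw [toForm, Fin.sum_univ_three]
  rw [this]
  exact ((hi 0).add (hi 1)).add (hi 2)

lemma HasComp.isTangential_iff {p : S2 → E3 →L[ℝ] ℝ} {q : Fin 3 → SmoothFun} (h : HasComp p q) :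
    (∀ x : S2, p x x = 0) ↔ IsTangential q := by
  have hx : ∀ x : S2, p x x = (coord 0 * q 0 + coord 1 * q 1 + coord 2 * q 2) x := fun x => by
    have h1 : p x (x : E3) = p x (∑ i, (x : E3) i • e i) := by rw [← eq_sum_e]
    rw [h1]
    simp [Fin.sum_univ_three, h x _]
  constructor
  · intro h0
    exact ContMDiffMap.ext fun x => by rw [← hx, h0]; rfl
  · intro h0 x
    rw [hx, h0]; rfl

lemma HasComp.isOneForm {p : S2 → E3 →L[ℝ] ℝ} {q : Fin 3 → SmoothFun} (h : HasComp p q)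
    (hq : IsTangential q) : IsOneForm p :=
  ⟨h.isSmooth, h.isTangential_iff.2 hq⟩

lemma IsSmooth.clm_apply_const {F : Type*} [NormedAddCommGroup F] [NormedSpace ℝ F]
    {p : S2 → E3 →L[ℝ] F} (hp : IsSmooth p) (v : E3) : IsSmooth fun x => p x v :=
  (ContinuousLinearMap.apply ℝ F v).contDiff.contMDiff.comp hp

lemma IsOneForm.exists_comp {p : S2 → E3 →L[ℝ] ℝ} (hp : IsOneForm p) :
    ∃ q : Fin 3 → SmoothFun, HasComp p q ∧ IsTangential q := by
  have h : HasComp p fun i => ⟨fun x => p x (e i), hp.smooth.clm_apply_const (e i)⟩ :=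
    fun x i => rfl
  exact ⟨_, h, h.isTangential_iff.1 hp.tangential⟩

lemma exists_comp₂ {S : S2 → E3 →L[ℝ] E3 →L[ℝ] ℝ} (hS : IsTwoTensor S) (hs : IsSymmetric S)
    (ht : IsTraceless S) : ∃ Q : Fin 3 → Fin 3 → SmoothFun, HasComp₂ S Q ∧ IsTraceFree Q := by
  let Q : Fin 3 → Fin 3 → SmoothFun := fun i j =>
    ⟨fun x => S x (e i) (e j), (hS.smooth.clm_apply_const (e i)).clm_apply_const (e j)⟩
  refine ⟨Q, fun x i j => rfl, ?_, ?_, ?_⟩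
  · exact fun i j => ContMDiffMap.ext fun x => hs x (e i) (e j)
  · intro j
    have h : HasComp (fun x => (S x).flip (e j)) fun i => Q i j := fun x i => rfl
    exact h.isTangential_iff.1 fun x => hS.tangential_left x (e j)
  · refine ContMDiffMap.ext fun x => ?_
    have := ht x
    rw [Fin.sum_univ_three] at this
    exact this

lemma tderiv_clm_apply {F : Type*} [NormedAddCommGroup F] [NormedSpace ℝ F] {p : S2 → E3 →L[ℝ] F}
    (hp : IsSmooth p) (x : S2) (v w : E3) : tderiv p x v w = tderiv (fun y => p y w) x v := by
  have h : radialExt (fun y => p y w) = fun y => radialExt p y w := by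
    ext y; by_cases hy : y = 0 <;> simp [radialExt, hy]
  have hd := (hp.differentiableAt_radialExt (ne_zero x)).hasFDerivAt
  have hd' := hd.clm_apply (hasFDerivAt_const w (x : E3))
  rw [tderiv, tderiv, h, hd'.fderiv]
  simp

lemma proj_e (x : S2) (j : Fin 3) : proj x (e j) = e j - (x : E3) j • ∑ k, (x : E3) k • e k := by
  rw [← eq_sum_e]
  simp [proj, inner_e]

lemma e_apply (i j : Fin 3) : e i j = if i = j then (1 : ℝ) else 0 := by
  simp [e, eq_comm]

lemma HasComp.tderiv_apply {p : S2 → E3 →L[ℝ] ℝ} {q : Fin 3 → SmoothFun} (h : HasComp p q)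
    (x : S2) (i j : Fin 3) : tderiv p x (e i) (e j) = tanDeriv i (q j) x := by
  rw [tderiv_clm_apply h.isSmooth, tanDeriv_apply]
  congr 2
  exact funext fun y => h y j

lemma HasComp.nablaOne_apply {p : S2 → E3 →L[ℝ] ℝ} {q : Fin 3 → SmoothFun} (h : HasComp p q)
    (hq : IsTangential q) (x : S2) (i j : Fin 3) :
    nablaOne p x (e i) (e j) = covDeriv q i j x := by
  have h1 := DFunLike.congr_fun (hq.sum_coord_mul_tanDeriv i) x
  simp only [nablaOne, ContinuousLinearMap.comp_apply, proj_e, Fin.sum_univ_three,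
    map_sub, map_smul, map_add, h.tderiv_apply, smul_eq_mul, covDeriv]
  simp at h1 ⊢
  linear_combination (-(x : E3) j) * h1

lemma nablaOne_bilin (p : S2 → E3 →L[ℝ] ℝ) (x : S2) (v w : E3) :
    nablaOne p x v w = ∑ i, ∑ j, v i * w j * nablaOne p x (e i) (e j) :=
  bilin_apply ((tderiv p x).bilinearComp (ContinuousLinearMap.id ℝ E3) (proj x)) v w

lemma HasComp.divOne_apply {p : S2 → E3 →L[ℝ] ℝ} {q : Fin 3 → SmoothFun} (h : HasComp p q)
    (hq : IsTangential q) (x : S2) : divOne p x = dvg q x := by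
  have hq' := DFunLike.congr_fun (show coord 0 * q 0 + coord 1 * q 1 + coord 2 * q 2 = 0 from hq) x
  simp only [divOne, h.nablaOne_apply hq, Fin.sum_univ_three, covDeriv, dvg]
  simp at hq' ⊢
  linear_combination hq'

lemma areaForm_apply (x : S2) (u v : E3) : areaForm x u v =
    ((x : E3) 1 * u 2 - (x : E3) 2 * u 1) * v 0 + ((x : E3) 2 * u 0 - (x : E3) 0 * u 2) * v 1 +
      ((x : E3) 0 * u 1 - (x : E3) 1 * u 0) * v 2 := by
  simp [areaForm, crossProduct, PiLp.inner_apply, Fin.sum_univ_three]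
  ring

lemma HasComp.curlOne_apply {p : S2 → E3 →L[ℝ] ℝ} {q : Fin 3 → SmoothFun} (h : HasComp p q)
    (hq : IsTangential q) (x : S2) : curlOne p x = crl q x := by
  simp only [curlOne, h.nablaOne_apply hq, Fin.sum_univ_three, areaForm_apply, e_apply, covDeriv,
    crl]
  simp
  ring

lemma hasComp_nablaFun (f : SmoothFun) : HasComp (nablaFun f) (grad f) := fun _ _ => rfl

lemma HasComp.rot {p : S2 → E3 →L[ℝ] ℝ} {q : Fin 3 → SmoothFun} (h : HasComp p q) :
    HasComp (rot p) (cross q) := fun x j => by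
  simp only [SphereTensor.rot, Fin.sum_univ_three, add_apply, smul_apply, areaForm_apply, e_apply,
    h x _]
  fin_cases j <;> simp <;> ring

lemma HasComp.sub {p p' : S2 → E3 →L[ℝ] ℝ} {q q' : Fin 3 → SmoothFun} (h : HasComp p q)
    (h' : HasComp p' q') : HasComp (p - p') (q - q') := fun x i => by
  simp [h x i, h' x i]

lemma HasComp.isClosedForm_iff {p : S2 → E3 →L[ℝ] ℝ} {q : Fin 3 → SmoothFun} (h : HasComp p q)
    (hq : IsTangential q) : IsClosedForm p ↔ crl q = 0 := by
  constructor
  · intro hc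
    refine crl_eq_zero_of_covDeriv_comm fun i j => ContMDiffMap.ext fun x => ?_
    rw [← h.nablaOne_apply hq, ← h.nablaOne_apply hq]
    exact sub_eq_zero.1 (hc x (e i) (e j))
  · intro hc x v w
    rw [nablaOne_bilin p x v w, nablaOne_bilin p x w v]
    simp only [h.nablaOne_apply hq, Fin.sum_univ_three, covDeriv_comm_of_crl_eq_zero hq hc 1 0,
      covDeriv_comm_of_crl_eq_zero hq hc 2 0, covDeriv_comm_of_crl_eq_zero hq hc 2 1]
    ring

lemma HasComp.isCoclosedForm_iff {p : S2 → E3 →L[ℝ] ℝ} {q : Fin 3 → SmoothFun} (h : HasComp p q)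
    (hq : IsTangential q) : IsCoclosedForm p ↔ dvg q = 0 := by
  constructor
  · intro hc
    exact ContMDiffMap.ext fun x => by rw [← h.divOne_apply hq]; exact hc x
  · intro hc x
    rw [h.divOne_apply hq, hc]; rfl

lemma laplacian_eq (f : SmoothFun) : laplacian f = lap f :=
  funext fun x => (hasComp_nablaFun f).divOne_apply (isTangential_grad f) x

lemma HasComp₂.tderiv_apply {S : S2 → E3 →L[ℝ] E3 →L[ℝ] ℝ} {Q : Fin 3 → Fin 3 → SmoothFun}
    (hS : IsSmooth S) (h : HasComp₂ S Q) (x : S2) (k i j : Fin 3) :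
    tderiv S x (e k) (e i) (e j) = tanDeriv k (Q i j) x := by
  rw [tderiv_clm_apply hS, tderiv_clm_apply (hS.clm_apply_const (e i)), tanDeriv_apply]
  congr 2
  exact funext fun y => h y i j

/-- The tangential projections in `∇^α S_αβ` contribute only terms that vanish because `S` is
tangential and traceless. -/
lemma HasComp₂.divTwo {S : S2 → E3 →L[ℝ] E3 →L[ℝ] ℝ} {Q : Fin 3 → Fin 3 → SmoothFun}
    (hS : IsSmooth S) (h : HasComp₂ S Q) (hQ : IsTraceFree Q) : HasComp (divTwo S) (dvgTwo Q) := by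
  intro x j
  have hT : ∀ k j, (x : E3) 0 * tanDeriv k (Q 0 j) x + (x : E3) 1 * tanDeriv k (Q 1 j) x +
      (x : E3) 2 * tanDeriv k (Q 2 j) x = -Q k j x := fun k j => by
    have h1 := DFunLike.congr_fun ((hQ.tangential j).sum_coord_mul_tanDeriv k) x
    simpa using h1
  have hq : ∀ j, (x : E3) 0 * Q 0 j x + (x : E3) 1 * Q 1 j x + (x : E3) 2 * Q 2 j x = 0 :=
    fun j => by
      have h1 := DFunLike.congr_fun (show coord 0 * Q 0 j + coord 1 * Q 1 j + coord 2 * Q 2 j = 0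
        from hQ.tangential j) x
      simpa using h1
  have htr : Q 0 0 x + Q 1 1 x + Q 2 2 x = 0 := by
    have h1 := DFunLike.congr_fun hQ.trace x
    simpa using h1
  have hk : ∀ k, nablaTwo S x (e k) (e k) (e j) = tanDeriv k (Q k j) x + (x : E3) k * Q k j x +
      (x : E3) j * Q k k x := fun k => by
    have hs : ∀ m, tanDeriv k (Q k m) x = tanDeriv k (Q m k) x := fun m => by rw [hQ.symm k m]
    have hs' : ∀ m, Q k m x = Q m k x := fun m => by rw [hQ.symm k m]
    simp only [nablaTwo, ContinuousLinearMap.bilinearComp_apply, proj_e, Fin.sum_univ_three,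
      map_sub, map_smul, map_add, sub_apply, add_apply, smul_apply, h.tderiv_apply hS, smul_eq_mul]
    have a0 := hT k 0
    have a1 := hT k 1
    have a2 := hT k 2
    have ak := hT k k
    rw [hs'] at a0 a1 a2
    rw [← hs, ← hs, ← hs] at ak
    linear_combination (-(x : E3) k) * hT k j - (x : E3) j * ak + (x : E3) k * (x : E3) j *
      ((x : E3) 0 * a0 + (x : E3) 1 * a1 + (x : E3) 2 * a2) - (x : E3) k * (x : E3) j * hq k
  rw [SphereTensor.divTwo, sum_apply, Fin.sum_univ_three, hk, hk, hk, dvgTwo]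
  simp only [ContMDiffMap.coe_add, Pi.add_apply]
  linear_combination hq j + (x : E3) j * htr

lemma metric_apply (x : S2) (v w : E3) :
    metric x v w = ∑ i, ∑ j, v i * w j * metricComp i j x := by
  have h : ∀ i j, metric x (e i) (e j) = metricComp i j x := fun i j => by
    have hp : ∀ i, proj x (e i) = e i - (x : E3) i • (x : E3) := fun i => by
      rw [proj_e, ← eq_sum_e]
    have h1 : ((if i = j then 1 else 0 : SmoothFun) : S2 → ℝ) x = if i = j then (1 : ℝ) else 0 := by
      split_ifs <;> rfl
    rw [metric, hp, hp, metricComp, ContMDiffMap.coe_sub, Pi.sub_apply, h1]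
    simp only [inner_sub_left, inner_sub_right, inner_smul_left, inner_smul_right, inner_e,
      real_inner_comm (x : E3) (e _), e_apply]
    simp
  rw [show metric x v w = (innerSL ℝ : E3 →L[ℝ] E3 →L[ℝ] ℝ).bilinearComp (proj x) (proj x) v w
    from rfl, bilin_apply]
  simp only [← h]
  rfl

lemma hasPotential_iff {S : S2 → E3 →L[ℝ] E3 →L[ℝ] ℝ} {Q : Fin 3 → Fin 3 → SmoothFun}
    (hSQ : HasComp₂ S Q) {p : S2 → E3 →L[ℝ] ℝ} {q : Fin 3 → SmoothFun} (h : HasComp p q)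
    (hq : IsTangential q) : HasPotential S p ↔ ∀ i j, 2 * Q i j = killing q i j := by
  have hk : ∀ x i j, killing q i j x = nablaOne p x (e j) (e i) + nablaOne p x (e i) (e j) -
      divOne p x * metricComp i j x := fun x i j => by
    rw [h.nablaOne_apply hq, h.nablaOne_apply hq, h.divOne_apply hq]
    simp [killing]
  have hm : ∀ x i j, metric x (e i) (e j) = metricComp i j x := fun x i j => by
    rw [metric_apply]
    simp [e_apply]
  constructor
  · intro hp i j
    refine ContMDiffMap.ext fun x => ?_
    have h1 := hp x (e i) (e j)
    rw [hSQ x i j, hm] at h1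
    rw [hk, ContMDiffMap.coe_mul, Pi.mul_apply, SmoothFun.two_apply, h1]
    ring
  · intro hp x v w
    have h2 : ∀ i j, Q i j x = 1 / 2 * (nablaOne p x (e j) (e i) + nablaOne p x (e i) (e j) -
      divOne p x * metricComp i j x) := fun i j => by
      have := DFunLike.congr_fun (hp i j) x
      rw [hk, ContMDiffMap.coe_mul, Pi.mul_apply, SmoothFun.two_apply] at this
      linarith
    rw [bilin_apply (S x), nablaOne_bilin p x v w, nablaOne_bilin p x w v, metric_apply]
    simp only [hSQ x _ _, h2, Fin.sum_univ_three]
    ring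

lemma isClosedRep_iff {S : S2 → E3 →L[ℝ] E3 →L[ℝ] ℝ} {Q : Fin 3 → Fin 3 → SmoothFun}
    (hSQ : HasComp₂ S Q) (f : SmoothFun) :
    IsClosedRep S f ↔ ∀ i j, 2 * Q i j = killing (grad f) i j := by
  rw [← hasPotential_iff hSQ (hasComp_nablaFun f) (isTangential_grad f)]
  have hc := ((hasComp_nablaFun f).isClosedForm_iff (isTangential_grad f)).2 (crl_grad f)
  refine forall₃_congr fun x v w => ?_
  have h1 := sub_eq_zero.1 (hc x v w)
  have h2 : hess f x v w = nablaOne (nablaFun f) x v w := rfl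
  have h3 : laplacian f x = divOne (nablaFun f) x := rfl
  rw [h2, h3, ← h1]
  ring_nf

lemma isCoclosedRep_iff {S : S2 → E3 →L[ℝ] E3 →L[ℝ] ℝ} {Q : Fin 3 → Fin 3 → SmoothFun}
    (hSQ : HasComp₂ S Q) (g : SmoothFun) :
    IsCoclosedRep S g ↔ ∀ i j, 2 * Q i j = cross (fun k => covDeriv (grad g) j k) i +
      cross (fun k => covDeriv (grad g) i k) j := by
  have h : ∀ x i j, hess g x (e i) (e j) = covDeriv (grad g) i j x := fun x i j =>
    (hasComp_nablaFun g).nablaOne_apply (isTangential_grad g) x i j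
  have hrot : ∀ (x : S2) (v w : E3), ∑ k, areaForm x (e k) v * hess g x w (e k) =
      ∑ i, ∑ j, v i * w j * cross (fun k => covDeriv (grad g) j k) i x := fun x v w => by
    have hb : ∀ k, hess g x w (e k) = ∑ j, w j * covDeriv (grad g) j k x := fun k => by
      have := nablaOne_bilin (nablaFun g) x w (e k)
      rw [hess, this]
      refine Finset.sum_congr rfl fun j _ => ?_
      rw [← h x j k]
      simp [e_apply, hess]
    simp only [hb, areaForm_apply, e_apply, Fin.sum_univ_three]
    simp
    ring
  constructor
  · intro hg i j
    refine ContMDiffMap.ext fun x => ?_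
    have h1 := hg x (e i) (e j)
    rw [hSQ x i j, hrot, hrot] at h1
    simp only [ContMDiffMap.coe_mul, ContMDiffMap.coe_add, Pi.mul_apply, Pi.add_apply,
      SmoothFun.two_apply, h1]
    simp [e_apply]
  · intro hg x v w
    have h2 : ∀ i j, Q i j x = 1 / 2 * (cross (fun k => covDeriv (grad g) j k) i x +
      cross (fun k => covDeriv (grad g) i k) j x) := fun i j => by
      have := DFunLike.congr_fun (hg i j) x
      simp only [ContMDiffMap.coe_mul, ContMDiffMap.coe_add, Pi.mul_apply, Pi.add_apply,
        SmoothFun.two_apply] at this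
      linarith
    rw [bilin_apply (S x), hrot, hrot]
    simp only [hSQ x _ _, h2, Fin.sum_univ_three]
    ring

lemma isLowHarmonic_iff (u : SmoothFun) :
    IsLowHarmonic u ↔ ∀ i j, killing (grad u) i j = 0 := by
  rw [killing_grad_eq_zero_iff]
  refine exists₂_congr fun a b => ?_
  rw [DFunLike.ext_iff]
  refine forall_congr' fun x => ?_
  rw [coordFun_eq, ContMDiffMap.coe_add, Pi.add_apply, constFun_apply]

end SphereTensor

end

theorem mainTheorem9 (S : S2 → E3 →L[ℝ] E3 →L[ℝ] ℝ) (hS : IsTwoTensor S)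
    (hsymm : IsSymmetric S) (htraceless : IsTraceless S) :
    (∃ p : S2 → E3 →L[ℝ] ℝ, IsOneForm p ∧ HasPotential S p) ∧
    (IsClosedForm (divTwo S) →
      (∃ p : S2 → E3 →L[ℝ] ℝ, IsOneForm p ∧ HasPotential S p ∧ IsClosedForm p) ∧
      (∀ p : S2 → E3 →L[ℝ] ℝ, IsOneForm p → HasPotential S p →
        ∃ b : E3, IsClosedForm (p - rot (nablaFun (coordFun b)))) ∧
      ∃ f : S2 → ℝ, IsSmooth f ∧ IsClosedRep S f ∧
        (∀ x : S2, divTwo S x =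
          (1 / 2 : ℝ) • nablaFun (fun y => laplacian f y + 2 * f y) x) ∧
        (∀ x : S2, divOne (divTwo S) x =
          1 / 2 * laplacian (fun y => laplacian f y + 2 * f y) x) ∧
        ∀ f' : S2 → ℝ, IsSmooth f' → (IsClosedRep S f' ↔ IsLowHarmonic (f' - f))) ∧
    (IsCoclosedForm (divTwo S) →
      ∃ g : S2 → ℝ, IsSmooth g ∧ IsCoclosedRep S g ∧
        (∀ x : S2, curlOne (divTwo S) x =
          1 / 2 * laplacian (fun y => laplacian g y + 2 * g y) x) ∧
        ∀ g' : S2 → ℝ, IsSmooth g' → (IsCoclosedRep S g' ↔ IsLowHarmonic (g' - g))) := by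
  obtain ⟨Q, hSQ, hQ⟩ := exists_comp₂ hS hsymm htraceless
  have hdiv := hSQ.divTwo hS.smooth hQ
  have htan := isTangential_dvgTwo hQ
  have hgrad : ∀ f : SmoothFun, (fun y => laplacian f y + 2 * f y) = (lap f + 2 * f : SmoothFun) :=
    fun f => funext fun x => by simp [laplacian_eq]
  refine ⟨?_, fun hc => ⟨?_, ?_, ?_⟩, fun hc => ?_⟩
  · obtain ⟨q, hq, h⟩ := exists_killing hQ
    exact ⟨toForm q, (hasComp_toForm q).isOneForm hq,
      (hasPotential_iff hSQ (hasComp_toForm q) hq).2 h⟩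
  · obtain ⟨f, hf⟩ := exists_killing_grad hQ ((hdiv.isClosedForm_iff htan).1 hc)
    have ht := isTangential_grad f
    have hf' := hasComp_nablaFun f
    exact ⟨nablaFun f, hf'.isOneForm ht, (hasPotential_iff hSQ hf' ht).2 hf,
      (hf'.isClosedForm_iff ht).2 (crl_grad f)⟩
  · intro p hp hpS
    obtain ⟨q, hq, ht⟩ := hp.exists_comp
    obtain ⟨b, hb⟩ := exists_crl_sub_eq_zero ht ((hasPotential_iff hSQ hq ht).1 hpS)
      ((hdiv.isClosedForm_iff htan).1 hc)
    refine ⟨b, ?_⟩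
    rw [coordFun_eq]
    exact ((hq.sub (hasComp_nablaFun _).rot).isClosedForm_iff
      (ht.sub (isTangential_cross _))).2 hb
  · obtain ⟨f, hf⟩ := exists_killing_grad hQ ((hdiv.isClosedForm_iff htan).1 hc)
    have hd := dvgTwo_of_grad hf
    refine ⟨f, f.isSmooth, (isClosedRep_iff hSQ f).2 hf, fun x => clm_ext fun i => ?_,
      fun x => ?_, fun f' hf' => ?_⟩
    · have h1 := DFunLike.congr_fun (hd i) x
      rw [ContMDiffMap.coe_mul, Pi.mul_apply, SmoothFun.two_apply] at h1
      rw [hdiv x i, hgrad, smul_apply, hasComp_nablaFun _ x i, grad, ← h1, smul_eq_mul]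
      ring
    · have h1 : 2 * dvg (dvgTwo Q) = lap (lap f + 2 * f) := two_mul_dvg_of_grad hd
      rw [hdiv.divOne_apply htan, hgrad, laplacian_eq, ← h1, ContMDiffMap.coe_mul, Pi.mul_apply,
        SmoothFun.two_apply]
      ring
    · obtain ⟨F, rfl⟩ : ∃ F : SmoothFun, ⇑F = f' := ⟨⟨f', hf'⟩, rfl⟩
      rw [isClosedRep_iff hSQ F, ← ContMDiffMap.coe_sub, isLowHarmonic_iff (F - f)]
      refine forall₂_congr fun i j => ?_
      rw [hf, killing_grad_sub, sub_eq_zero, eq_comm]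
  -- the dual tensor has closed divergence, and its potential is `-g`
  · have hT := isTraceFree_dualTensor hQ
    obtain ⟨f, hf⟩ := exists_killing_grad hT (by
      rw [dvgTwo_dualTensor hQ, crl_cross htan, ← hdiv.isCoclosedForm_iff htan]
      exact hc)
    have hrep : ∀ g : SmoothFun, IsCoclosedRep S g ↔
        ∀ i j, 2 * dualTensor Q i j = killing (grad (-g)) i j := fun g =>
      (isCoclosedRep_iff hSQ g).trans (rotated_hessian_iff hQ g)
    have hd := dvgTwo_of_grad hf
    refine ⟨(-f : SmoothFun), (-f).isSmooth, (hrep (-f)).2 (by rwa [neg_neg]), fun x => ?_,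
      fun g' hg' => ?_⟩
    · have h1 : 2 * crl (dvgTwo Q) = lap (lap (-f) + 2 * -f) := by
        have h2 : 2 * dvg (dvgTwo (dualTensor Q)) = lap (lap f + 2 * f) := two_mul_dvg_of_grad hd
        rw [dvgTwo_dualTensor hQ, dvg_cross] at h2
        rw [lap_neg, show -lap f + 2 * -f = -(lap f + 2 * f) by ring, lap_neg, ← h2]
        ring
      rw [hdiv.curlOne_apply htan, hgrad, laplacian_eq, ← h1, ContMDiffMap.coe_mul, Pi.mul_apply,
        SmoothFun.two_apply]
      ring
    · obtain ⟨G, rfl⟩ : ∃ G : SmoothFun, ⇑G = g' := ⟨⟨g', hg'⟩, rfl⟩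
      rw [hrep, ← ContMDiffMap.coe_sub, isLowHarmonic_iff (G - -f)]
      refine forall₂_congr fun i j => ?_
      rw [hf, show G - -f = f - -G by ring, killing_grad_sub, sub_eq_zero]
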